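/- Let $n\ge 2$ and let $D\subset\mathbb{R}^n$ be a bounded strongly convex domain with smooth boundary, i.e. a nonempty bounded open convex set whose boundary is a $C^\infty$ hypersurface with positive definite second fundamental form. For $x\in D$ and $v\in T_xD=\mathbb{R}^n$, $v\neq 0$, let $b$ be the point where the ray from $x$ in the direction $v$ meets $\partial D$, and let $F(x,v)=|v|/|x-b|$, $F(x,0)=0$, be the Funk metric. Then $F$ is a $C^\infty$ Finsler structure on $D$: it is nonnegative, positively $1$-homogeneous in $v$, smooth off the zero section, and $g_{ij}(v)=\frac12\,\partial^2(F^2)/\partial v^i\partial v^j$ is positive definite for $v\ne0$. Let $m_{\mathbf L}$ be the Lebesgue measure restricted to $D$. For a unit vector $v\in T_xD$ (that is, $F(x,v)=1$), let $\mathrm{Ric}(v)$ denote the Finsler Ricci curvature of $F$ (the trace of the flag curvature of the Chern connection), let $\eta:(-\varepsilon,\varepsilon)\to D$ be the geodesic (smooth locally minimizing curve of constant speed) with $\dot\eta(0)=v$, and write $m_{\mathbf L}=e^{-\Psi}\,\mathrm{vol}_{\dot\eta}$ along $\eta$, where $\mathrm{vol}_{\dot\eta}=\sqrt{\det g_{ij}(\dot\eta)}\,dx^1\cdots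 dx^n$. The weighted Ricci curvature is $$\mathrm{Ric}_\infty(v)=\mathrm{Ric}(v)+\Psi''(0),\qquad \mathrm{Ric}_N(v)=\mathrm{Ric}(v)+\Psi''(0)-\frac{\Psi'(0)^2}{N-n}\quad\text{for } N\in(n,\infty).$$ Then for every $x\in D$ and every unit vector $v\in T_xD$ these quantities are well defined (such a geodesic exists, and the values do not depend on its choice), and $$\mathrm{Ric}_\infty(v)=-\frac{n-1}{4},\qquad \mathrm{Ric}_N(v)=-\frac{n-1}{4}-\frac{(n+1)^2}{4(N-n)}\quad\text{for every } N\in(n,\infty).$$ In particular these values do not depend on the domain $D$. -/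

import Mathlib

open scoped ContDiff

namespace FunkGeometry

/-- The model space `ℝⁿ` with the Euclidean norm. -/
abbrev Euc (n : ℕ) : Type := EuclideanSpace ℝ (Fin n)

section Domain

variable {n : ℕ}

/-- Strongly convex (bounded) domains of `ℝⁿ` with smooth boundary: near each boundary point `p`
the domain is `{ρ < 0}` for a smooth `ρ` with nonzero differential at `p`, and the boundary is
positively curved at `p`, i.e. the Hessian of `ρ` is positive on nonzero tangent vectors. -/
structure IsStronglyConvexDomain (D : Set (Euc n)) : Prop where
  isOpen : IsOpen D
  nonempty : D.Nonempty
  convex : Convex ℝ D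
  isBounded : Bornology.IsBounded D
  boundary : ∀ p ∈ frontier D, ∃ (U : Set (Euc n)) (ρ : Euc n → ℝ),
    IsOpen U ∧ p ∈ U ∧ ContDiffOn ℝ ∞ ρ U ∧ D ∩ U = {y | ρ y < 0} ∩ U ∧
    fderiv ℝ ρ p ≠ 0 ∧
    ∀ w : Euc n, w ≠ 0 → fderiv ℝ ρ p w = 0 → 0 < fderiv ℝ (fderiv ℝ ρ) p w w

/-- The parameter `t > 0` at which the ray `x + t v` issuing from `x ∈ D` meets the boundary
(there is exactly one for `D` bounded, open and convex and `v ≠ 0`). -/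
noncomputable def exitTime (D : Set (Euc n)) (x v : Euc n) : ℝ :=
  sInf {t : ℝ | 0 < t ∧ x + t • v ∈ frontier D}

/-- The Funk metric `F(x, v) = |v| / |x - b|`, where `b` is the boundary point on the ray from
`x` in the direction `v`; `F(x, 0) = 0`. -/
noncomputable def funkMetric (D : Set (Euc n)) (x v : Euc n) : ℝ :=
  ‖v‖ / ‖x - (x + exitTime D x v • v)‖

end Domain

/-! Finsler geometry of a function `F` on the tangent bundle `D × ℝⁿ` of an open set `D ⊆ ℝⁿ`,
in the standard coordinates `(xⁱ, vʲ)`. -/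

section Finsler

variable {n : ℕ}

/-- The horizontal coordinate derivative `∂f/∂xⁱ` at `(x, v)`. -/
noncomputable def partialX (f : Euc n → Euc n → ℝ) (i : Fin n) (x v : Euc n) : ℝ :=
  fderiv ℝ (fun y => f y v) x (EuclideanSpace.single i 1)

/-- The vertical coordinate derivative `∂f/∂vⁱ` at `(x, v)`. -/
noncomputable def partialV (f : Euc n → Euc n → ℝ) (i : Fin n) (x v : Euc n) : ℝ :=
  fderiv ℝ (fun w => f x w) v (EuclideanSpace.single i 1)

/-- The fundamental tensor `g_{ij}(v) = (1/2) ∂²(F²)/∂vⁱ∂vʲ`. -/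
noncomputable def fundTensor (F : Euc n → Euc n → ℝ) (x v : Euc n) :
    Matrix (Fin n) (Fin n) ℝ :=
  Matrix.of fun i j => (1 / 2 : ℝ) * partialV (partialV (fun y w => F y w ^ 2) j) i x v

/-- `C^∞`-Finsler structures on the open set `D`. -/
structure IsFinslerStructure (D : Set (Euc n)) (F : Euc n → Euc n → ℝ) : Prop where
  nonneg : ∀ x ∈ D, ∀ v, 0 ≤ F x v
  smooth : ContDiffOn ℝ ∞ (fun p : Euc n × Euc n => F p.1 p.2) (D ×ˢ {v | v ≠ 0})
  homogeneous : ∀ x ∈ D, ∀ v, ∀ c : ℝ, 0 < c → F x (c • v) = c * F x v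
  strongConvex : ∀ x ∈ D, ∀ v, v ≠ 0 → (fundTensor F x v).PosDef

/-- The inverse matrix `g^{ij}(v)`. -/
noncomputable def fundTensorInv (F : Euc n → Euc n → ℝ) (x v : Euc n) :
    Matrix (Fin n) (Fin n) ℝ :=
  (fundTensor F x v)⁻¹

/-- The Cartan tensor `C_{ijk} = (1/2) ∂g_{ij}/∂vᵏ = (1/4) ∂³(F²)/∂vⁱ∂vʲ∂vᵏ`. -/
noncomputable def cartan (F : Euc n → Euc n → ℝ) (i j k : Fin n) (x v : Euc n) : ℝ :=
  (1 / 2 : ℝ) * partialV (fun y w => fundTensor F y w i j) k x v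

/-- The formal Christoffel symbols
`γⁱ_{jk} = (1/2) g^{is} (∂g_{sj}/∂xᵏ - ∂g_{jk}/∂xˢ + ∂g_{ks}/∂xʲ)`. -/
noncomputable def formalChristoffel (F : Euc n → Euc n → ℝ) (i j k : Fin n)
    (x v : Euc n) : ℝ :=
  (1 / 2 : ℝ) * ∑ s, fundTensorInv F x v i s *
    (partialX (fun y w => fundTensor F y w s j) k x v
      - partialX (fun y w => fundTensor F y w j k) s x v
      + partialX (fun y w => fundTensor F y w k s) j x v)

/-- The nonlinear connection `Nⁱ_j = γⁱ_{jk} vᵏ - Cⁱ_{jk} γᵏ_{rs} vʳ vˢ`,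
with `Cⁱ_{jk} = g^{il} C_{ljk}`. -/
noncomputable def nonlinearConn (F : Euc n → Euc n → ℝ) (i j : Fin n) (x v : Euc n) : ℝ :=
  (∑ k, formalChristoffel F i j k x v * v k)
    - ∑ k, (∑ l, fundTensorInv F x v i l * cartan F l j k x v) *
        (∑ r, ∑ s, formalChristoffel F k r s x v * v r * v s)

/-- The horizontal derivative `δf/δxʲ = ∂f/∂xʲ - Nⁱ_j ∂f/∂vⁱ`. -/
noncomputable def horizDeriv (F f : Euc n → Euc n → ℝ) (j : Fin n) (x v : Euc n) : ℝ :=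
  partialX f j x v - ∑ i, nonlinearConn F i j x v * partialV f i x v

/-- The coefficients of the Chern connection,
`Γⁱ_{jk} = (1/2) g^{is} (δg_{sj}/δxᵏ - δg_{jk}/δxˢ + δg_{ks}/δxʲ)`. -/
noncomputable def chernConn (F : Euc n → Euc n → ℝ) (i j k : Fin n) (x v : Euc n) : ℝ :=
  (1 / 2 : ℝ) * ∑ s, fundTensorInv F x v i s *
    (horizDeriv F (fun y w => fundTensor F y w s j) k x v
      - horizDeriv F (fun y w => fundTensor F y w j k) s x v
      + horizDeriv F (fun y w => fundTensor F y w k s) j x v)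

/-- The `hh`-curvature of the Chern connection,
`R_jⁱ_{kl} = δΓⁱ_{jl}/δxᵏ - δΓⁱ_{jk}/δxˡ + Γⁱ_{hk} Γʰ_{jl} - Γⁱ_{hl} Γʰ_{jk}`. -/
noncomputable def chernCurvature (F : Euc n → Euc n → ℝ) (j i k l : Fin n)
    (x v : Euc n) : ℝ :=
  horizDeriv F (chernConn F i j l) k x v - horizDeriv F (chernConn F i j k) l x v
    + ∑ h, (chernConn F i h k x v * chernConn F h j l x v
      - chernConn F i h l x v * chernConn F h j k x v)

/-- The Riemann curvature endomorphism `Rⁱ_k = vʲ R_jⁱ_{kl} vˡ`, whose normalized quadratic form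
with respect to `g_v` is the flag curvature with flagpole `v`. -/
noncomputable def riemannCurvature (F : Euc n → Euc n → ℝ) (x v : Euc n) :
    Matrix (Fin n) (Fin n) ℝ :=
  Matrix.of fun i k => ∑ j, ∑ l, v j * chernCurvature F j i k l x v * v l

/-- The Ricci curvature `Ric(v)` of `F`, the trace of the flag curvature. -/
noncomputable def ricci (F : Euc n → Euc n → ℝ) (x v : Euc n) : ℝ :=
  (riemannCurvature F x v).trace

/-- The nonsymmetric distance of `F`: the infimum of the lengths of the `C¹`-curves in `D`
from `x` to `y`, parametrized by `[0, 1]`. -/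
noncomputable def finslerDist (D : Set (Euc n)) (F : Euc n → Euc n → ℝ) (x y : Euc n) : ℝ :=
  sInf {L : ℝ | ∃ ξ : ℝ → Euc n, ContDiffOn ℝ 1 ξ (Set.Icc 0 1) ∧
    (∀ t ∈ Set.Icc (0 : ℝ) 1, ξ t ∈ D) ∧ ξ 0 = x ∧ ξ 1 = y ∧
    L = ∫ t in (0 : ℝ)..1, F (ξ t) (deriv ξ t)}

/-- Geodesics `(-ε, ε) → D`: smooth curves of constant speed that are locally minimizing. -/
structure IsGeodesic (D : Set (Euc n)) (F : Euc n → Euc n → ℝ) (ε : ℝ) (η : ℝ → Euc n) :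
    Prop where
  smooth : ContDiffOn ℝ ∞ η (Set.Ioo (-ε) ε)
  mapsTo : ∀ t ∈ Set.Ioo (-ε) ε, η t ∈ D
  constSpeed : ∃ c : ℝ, ∀ t ∈ Set.Ioo (-ε) ε, F (η t) (deriv η t) = c
  locallyMinimizing : ∀ t₀ ∈ Set.Ioo (-ε) ε, ∃ δ > 0,
    ∀ s ∈ Set.Ioo (-ε) ε ∩ Set.Ioo (t₀ - δ) (t₀ + δ),
    ∀ t ∈ Set.Ioo (-ε) ε ∩ Set.Ioo (t₀ - δ) (t₀ + δ), s ≤ t →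
      (∫ u in s..t, F (η u) (deriv η u)) = finslerDist D F (η s) (η t)

/-- `m` is the positive smooth measure `σ dx¹⋯dxⁿ` on `D`. -/
structure IsSmoothMeasure (D : Set (Euc n)) (m : MeasureTheory.Measure (Euc n))
    (σ : Euc n → ℝ) : Prop where
  smooth : ContDiffOn ℝ ∞ σ D
  pos : ∀ x ∈ D, 0 < σ x
  eq_withDensity : m = ((MeasureTheory.volume : MeasureTheory.Measure (Euc n)).restrict D).withDensity
    (fun x => ENNReal.ofReal (σ x))

/-- `m = e^{-Ψ} vol_{η'}` along `η : (-ε, ε) → D`, for the measure `m` of density `σ`; here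
`vol_{η'}` is the Riemannian volume of `g_{η'}`, of density `√(det g_{ij}(η'))`. -/
structure IsWeightAlong (F : Euc n → Euc n → ℝ) (σ : Euc n → ℝ) (ε : ℝ) (η : ℝ → Euc n)
    (Ψ : ℝ → ℝ) : Prop where
  smooth : ContDiffOn ℝ ∞ Ψ (Set.Ioo (-ε) ε)
  decomp : ∀ t ∈ Set.Ioo (-ε) ε,
    σ (η t) = Real.exp (-(Ψ t)) * Real.sqrt (fundTensor F (η t) (deriv η t)).det

/-- The expression defining `Ric_N` for `N ∈ [n, ∞]`, in terms of `Ric(v)`, `Ψ'(0)` and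
`Ψ''(0)`. -/
noncomputable def weightedRicciValue (n : ℕ) (N : EReal) (ric dΨ ddΨ : ℝ) : EReal :=
  open Classical in
  if N = ⊤ then ((ric + ddΨ : ℝ) : EReal)
  else if N = ((n : ℝ) : EReal) then
    (if dΨ = 0 then ((ric + ddΨ : ℝ) : EReal) else ⊥)
  else ((ric + ddΨ - dΨ ^ 2 / (N.toReal - n) : ℝ) : EReal)

/-- For a unit vector `v` at `x`, the weighted Ricci curvature `Ric_N(v)` of `(D, F, m)` is well
defined and equals `K`: `m` is a positive smooth measure, a geodesic `η` with `η'(0) = v` exists,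
and for each such geodesic the weight `Ψ` of `m` along `η` is a smooth function that
yields the value `K`. -/
def HasWeightedRicci (D : Set (Euc n)) (F : Euc n → Euc n → ℝ)
    (m : MeasureTheory.Measure (Euc n)) (N : EReal) (x v : Euc n) (K : EReal) : Prop :=
  ∃ σ : Euc n → ℝ, IsSmoothMeasure D m σ ∧
    (∃ ε > 0, ∃ η : ℝ → Euc n, IsGeodesic D F ε η ∧ η 0 = x ∧ deriv η 0 = v) ∧
    ∀ ε > 0, ∀ η : ℝ → Euc n, IsGeodesic D F ε η → η 0 = x → deriv η 0 = v →
      ∃ Ψ : ℝ → ℝ, IsWeightAlong F σ ε η Ψ ∧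
        weightedRicciValue n N (ricci F x v) (deriv Ψ 0) (deriv (deriv Ψ) 0) = K

end Finsler

end FunkGeometry

/-! `F(x, ·)` is the Minkowski gauge of `D - x`: the exit point `x + v / F(x, v)` lies on `∂D`. As
`x` or `v` varies, this point stays in the half-space bounded by the tangent hyperplane of `∂D` at
its initial position. A supporting functional is therefore stationary along the variation, and
comparing variations of `x` and `v` gives Okada's identity `∂F/∂xᵏ = F ∂F/∂vᵏ`
(`IsStronglyConvexDomain.okada`). Smoothness of `F` is the implicit function theorem. Positivity of
`g` comes from differentiating `ρ(x + v/F) = 0` twice in `v`.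

The curvature uses only Okada's identity and homogeneity. The identity makes `∂g_{ij}/∂xᵏ` totally
symmetric, so `Nⁱ_j = (F δⁱ_j + vⁱ ∂F/∂vʲ) / 2`, the function `F` is horizontally constant, and `R =
N² - F N = -(F² Id - F v ⊗ d_vF) / 4`. The trace is `-(n - 1) F² / 4` (`ricci_eq`).

For the weight, all unit-speed geodesics must be known. If `ℓ` is the differential of a defining
function at a boundary point `b`, then `ℓ(v) / (ℓ(b) - ℓ(x)) ≤ F(x, v)`, and the left side is the
derivative of `-log(ℓ(b) - ℓ(·))`: a calibration. It yields the distance formula, and by strict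
convexity equality forces `η + η' = b` (`IsGeodesic.eventually_add_deriv`). Hence `η'' = -η'`, and
along such a curve `log det g` has derivative `n + 1`. For Lebesgue measure `Ψ = (log det g) / 2`,
so `Ψ' = (n + 1) / 2` near `0` and `Ψ''(0) = 0`. -/

namespace FunkGeometry

/-! ### Calculus of coordinate derivatives on the tangent bundle. -/

section BundleCalculus

variable {n : ℕ} {Ω : Set (Euc n × Euc n)} {f g : Euc n → Euc n → ℝ} {x v : Euc n}

/-- Smoothness of a function of `(x, v)` on a subset of the tangent bundle. -/
def BundleSmooth (Ω : Set (Euc n × Euc n)) (f : Euc n → Euc n → ℝ) : Prop :=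
  ContDiffOn ℝ ∞ (fun p : Euc n × Euc n => f p.1 p.2) Ω

/-- The derivative of `f` at `(x, v)` in the direction `d` of the tangent bundle. -/
noncomputable def bundleDeriv (d : Euc n × Euc n) (f : Euc n → Euc n → ℝ) (x v : Euc n) : ℝ :=
  fderiv ℝ (fun p : Euc n × Euc n => f p.1 p.2) (x, v) d

theorem BundleSmooth.contDiffAt (hf : BundleSmooth Ω f) (hΩ : IsOpen Ω) (h : (x, v) ∈ Ω) :
    ContDiffAt ℝ ∞ (fun p : Euc n × Euc n => f p.1 p.2) (x, v) :=
  ContDiffOn.contDiffAt hf (hΩ.mem_nhds h)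

theorem BundleSmooth.differentiableAt (hf : BundleSmooth Ω f) (hΩ : IsOpen Ω)
    (h : (x, v) ∈ Ω) : DifferentiableAt ℝ (fun p : Euc n × Euc n => f p.1 p.2) (x, v) :=
  (hf.contDiffAt hΩ h).differentiableAt (by simp)

/-- Joint differentiability turns coordinate derivatives into values of one Fréchet derivative on
the product. The algebraic rules below, and the commutation of `x`- and `v`-derivatives, are
inherited from it. -/
theorem partialX_eq (hf : DifferentiableAt ℝ (fun p : Euc n × Euc n => f p.1 p.2) (x, v))
    (i : Fin n) : partialX f i x v = bundleDeriv (EuclideanSpace.single i 1, 0) f x v := by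
  have h1 : HasFDerivAt (fun y : Euc n => (y, v)) (ContinuousLinearMap.inl ℝ (Euc n) (Euc n)) x :=
    hasFDerivAt_prodMk_left x v
  have h2 := HasFDerivAt.comp x (hf.hasFDerivAt : HasFDerivAt _ _ ((fun y : Euc n => (y, v)) x)) h1
  have h3 := h2.fderiv
  simp only [Function.comp_def] at h3
  simp [partialX, bundleDeriv, h3]

theorem partialV_eq (hf : DifferentiableAt ℝ (fun p : Euc n × Euc n => f p.1 p.2) (x, v))
    (i : Fin n) : partialV f i x v = bundleDeriv (0, EuclideanSpace.single i 1) f x v := by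
  have h1 : HasFDerivAt (fun w : Euc n => (x, w)) (ContinuousLinearMap.inr ℝ (Euc n) (Euc n)) v :=
    hasFDerivAt_prodMk_right x v
  have h2 := HasFDerivAt.comp v (hf.hasFDerivAt : HasFDerivAt _ _ ((fun y : Euc n => (x, y)) v)) h1
  have h3 := h2.fderiv
  simp only [Function.comp_def] at h3
  simp [partialV, bundleDeriv, h3]

theorem BundleSmooth.congr (hf : BundleSmooth Ω f)
    (h : ∀ y w, (y, w) ∈ Ω → g y w = f y w) : BundleSmooth Ω g :=
  ContDiffOn.congr hf fun p hp => h p.1 p.2 hp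

theorem bundleDeriv_congr (hΩ : IsOpen Ω) (h : ∀ y w, (y, w) ∈ Ω → f y w = g y w)
    (hx : (x, v) ∈ Ω) (d : Euc n × Euc n) : bundleDeriv d f x v = bundleDeriv d g x v := by
  unfold bundleDeriv
  rw [Filter.EventuallyEq.fderiv_eq]
  filter_upwards [hΩ.mem_nhds hx] with p hp using h p.1 p.2 hp

theorem BundleSmooth.bundleDeriv (hf : BundleSmooth Ω f) (hΩ : IsOpen Ω) (d : Euc n × Euc n) :
    BundleSmooth Ω (bundleDeriv d f) := by
  have h : ContDiffOn ℝ ∞ (fderiv ℝ (fun p : Euc n × Euc n => f p.1 p.2)) Ω :=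
    ContDiffOn.fderiv_of_isOpen hf hΩ (by simp)
  exact h.clm_apply contDiffOn_const

theorem BundleSmooth.partialX (hf : BundleSmooth Ω f) (hΩ : IsOpen Ω) (i : Fin n) :
    BundleSmooth Ω (partialX f i) :=
  (hf.bundleDeriv hΩ _).congr fun _ _ h => partialX_eq (hf.differentiableAt hΩ h) i

theorem BundleSmooth.partialV (hf : BundleSmooth Ω f) (hΩ : IsOpen Ω) (i : Fin n) :
    BundleSmooth Ω (partialV f i) :=
  (hf.bundleDeriv hΩ _).congr fun _ _ h => partialV_eq (hf.differentiableAt hΩ h) i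

theorem BundleSmooth.const (c : ℝ) : BundleSmooth Ω (fun _ _ => c) := contDiffOn_const

theorem BundleSmooth.coord (i : Fin n) : BundleSmooth Ω (fun _ w => w i) := by
  have : ContDiff ℝ ∞ (fun p : Euc n × Euc n => p.2 i) := by fun_prop
  exact this.contDiffOn

theorem BundleSmooth.add (hf : BundleSmooth Ω f) (hg : BundleSmooth Ω g) :
    BundleSmooth Ω (fun y w => f y w + g y w) := ContDiffOn.add hf hg

theorem BundleSmooth.sub (hf : BundleSmooth Ω f) (hg : BundleSmooth Ω g) :
    BundleSmooth Ω (fun y w => f y w - g y w) := ContDiffOn.sub hf hg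

theorem BundleSmooth.mul (hf : BundleSmooth Ω f) (hg : BundleSmooth Ω g) :
    BundleSmooth Ω (fun y w => f y w * g y w) := ContDiffOn.mul hf hg

theorem BundleSmooth.sum {ι : Type*} {s : Finset ι} {F : ι → Euc n → Euc n → ℝ}
    (hf : ∀ i ∈ s, BundleSmooth Ω (F i)) : BundleSmooth Ω (fun y w => ∑ i ∈ s, F i y w) :=
  ContDiffOn.sum hf

theorem bundleDeriv_const (c : ℝ) (d : Euc n × Euc n) :
    bundleDeriv d (fun _ _ => c) x v = 0 := by
  simp [bundleDeriv]

theorem bundleDeriv_coord (i : Fin n) (d : Euc n × Euc n) :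
    bundleDeriv d (fun _ w => w i) x v = d.2 i := by
  have h : HasFDerivAt (fun p : Euc n × Euc n => p.2 i)
      ((EuclideanSpace.proj i : Euc n →L[ℝ] ℝ).comp (ContinuousLinearMap.snd ℝ (Euc n) (Euc n)))
      (x, v) :=
    ((EuclideanSpace.proj i : Euc n →L[ℝ] ℝ).comp
      (ContinuousLinearMap.snd ℝ (Euc n) (Euc n))).hasFDerivAt
  simp [bundleDeriv, h.fderiv]

theorem bundleDeriv_add (hf : DifferentiableAt ℝ (fun p : Euc n × Euc n => f p.1 p.2) (x, v))
    (hg : DifferentiableAt ℝ (fun p : Euc n × Euc n => g p.1 p.2) (x, v)) (d : Euc n × Euc n) :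
    bundleDeriv d (fun y w => f y w + g y w) x v = bundleDeriv d f x v + bundleDeriv d g x v := by
  simp [bundleDeriv, fderiv_fun_add hf hg]

theorem bundleDeriv_mul (hf : DifferentiableAt ℝ (fun p : Euc n × Euc n => f p.1 p.2) (x, v))
    (hg : DifferentiableAt ℝ (fun p : Euc n × Euc n => g p.1 p.2) (x, v)) (d : Euc n × Euc n) :
    bundleDeriv d (fun y w => f y w * g y w) x v =
      f x v * bundleDeriv d g x v + g x v * bundleDeriv d f x v := by
  simp [bundleDeriv, fderiv_fun_mul hf hg]

theorem bundleDeriv_sum {ι : Type*} {s : Finset ι} {F : ι → Euc n → Euc n → ℝ}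
    (hf : ∀ i ∈ s, DifferentiableAt ℝ (fun p : Euc n × Euc n => F i p.1 p.2) (x, v))
    (d : Euc n × Euc n) :
    bundleDeriv d (fun y w => ∑ i ∈ s, F i y w) x v = ∑ i ∈ s, bundleDeriv d (F i) x v := by
  simp [bundleDeriv, fderiv_fun_sum hf]

theorem bundleDeriv_comm (hf : BundleSmooth Ω f) (hΩ : IsOpen Ω) (hx : (x, v) ∈ Ω)
    (d e : Euc n × Euc n) :
    bundleDeriv d (bundleDeriv e f) x v = bundleDeriv e (bundleDeriv d f) x v := by
  set u := fun p : Euc n × Euc n => f p.1 p.2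
  have hs : IsSymmSndFDerivAt ℝ u (x, v) := (hf.contDiffAt hΩ hx).isSymmSndFDerivAt
    (by rw [minSmoothness_of_isRCLikeNormedField]; exact WithTop.coe_le_coe.2 le_top)
  have hd : DifferentiableAt ℝ (fderiv ℝ u) (x, v) :=
    (ContDiffAt.fderiv_right (m := 1) (hf.contDiffAt hΩ hx) (by norm_cast)).differentiableAt
      (by simp)
  have key : ∀ a b : Euc n × Euc n, bundleDeriv a (bundleDeriv b f) x v
      = fderiv ℝ (fderiv ℝ u) (x, v) a b := by
    intro a b
    have h := (hd.hasFDerivAt.clm_apply (hasFDerivAt_const b (x, v))).fderiv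
    change fderiv ℝ (fun p => fderiv ℝ u p b) (x, v) a = _
    rw [h]
    simp
  rw [key, key, hs.eq]

theorem sum_mul_bundleDeriv {c : Fin n → ℝ}
    (d : Fin n → Euc n × Euc n) :
    ∑ i, c i * bundleDeriv (d i) f x v = bundleDeriv (∑ i, c i • d i) f x v := by
  simp [bundleDeriv, map_sum]

theorem sum_mul_partialV (hf : DifferentiableAt ℝ (fun p : Euc n × Euc n => f p.1 p.2) (x, v))
    (w : Euc n) : ∑ i, w i * partialV f i x v = bundleDeriv (0, w) f x v := by
  simp only [partialV_eq hf, sum_mul_bundleDeriv]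
  congr 1
  ext j <;> simp [Prod.fst_sum, Prod.snd_sum, Pi.single_apply]

theorem sum_mul_partialX (hf : DifferentiableAt ℝ (fun p : Euc n × Euc n => f p.1 p.2) (x, v))
    (w : Euc n) : ∑ i, w i * partialX f i x v = bundleDeriv (w, 0) f x v := by
  simp only [partialX_eq hf, sum_mul_bundleDeriv]
  congr 1
  ext j <;> simp [Prod.fst_sum, Prod.snd_sum, Pi.single_apply]

theorem partialV_congr (hΩ : IsOpen Ω) (h : ∀ y w, (y, w) ∈ Ω → f y w = g y w)
    (hg : BundleSmooth Ω g) (hx : (x, v) ∈ Ω) (i : Fin n) :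
    partialV f i x v = partialV g i x v := by
  rw [partialV_eq ((hg.congr h).differentiableAt hΩ hx), partialV_eq (hg.differentiableAt hΩ hx),
    bundleDeriv_congr hΩ h hx]

theorem partialX_congr (hΩ : IsOpen Ω) (h : ∀ y w, (y, w) ∈ Ω → f y w = g y w)
    (hg : BundleSmooth Ω g) (hx : (x, v) ∈ Ω) (i : Fin n) :
    partialX f i x v = partialX g i x v := by
  rw [partialX_eq ((hg.congr h).differentiableAt hΩ hx), partialX_eq (hg.differentiableAt hΩ hx),
    bundleDeriv_congr hΩ h hx]

theorem partialV_add (hΩ : IsOpen Ω) (hf : BundleSmooth Ω f) (hg : BundleSmooth Ω g)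
    (hx : (x, v) ∈ Ω) (i : Fin n) :
    partialV (fun y w => f y w + g y w) i x v = partialV f i x v + partialV g i x v := by
  rw [partialV_eq ((hf.add hg).differentiableAt hΩ hx),
    bundleDeriv_add (hf.differentiableAt hΩ hx) (hg.differentiableAt hΩ hx),
    partialV_eq (hf.differentiableAt hΩ hx), partialV_eq (hg.differentiableAt hΩ hx)]

theorem partialX_add (hΩ : IsOpen Ω) (hf : BundleSmooth Ω f) (hg : BundleSmooth Ω g)
    (hx : (x, v) ∈ Ω) (i : Fin n) :
    partialX (fun y w => f y w + g y w) i x v = partialX f i x v + partialX g i x v := by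
  rw [partialX_eq ((hf.add hg).differentiableAt hΩ hx),
    bundleDeriv_add (hf.differentiableAt hΩ hx) (hg.differentiableAt hΩ hx),
    partialX_eq (hf.differentiableAt hΩ hx), partialX_eq (hg.differentiableAt hΩ hx)]

theorem partialV_mul (hΩ : IsOpen Ω) (hf : BundleSmooth Ω f) (hg : BundleSmooth Ω g)
    (hx : (x, v) ∈ Ω) (i : Fin n) :
    partialV (fun y w => f y w * g y w) i x v =
      f x v * partialV g i x v + g x v * partialV f i x v := by
  rw [partialV_eq ((hf.mul hg).differentiableAt hΩ hx),
    bundleDeriv_mul (hf.differentiableAt hΩ hx) (hg.differentiableAt hΩ hx),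
    partialV_eq (hf.differentiableAt hΩ hx), partialV_eq (hg.differentiableAt hΩ hx)]

theorem partialX_mul (hΩ : IsOpen Ω) (hf : BundleSmooth Ω f) (hg : BundleSmooth Ω g)
    (hx : (x, v) ∈ Ω) (i : Fin n) :
    partialX (fun y w => f y w * g y w) i x v =
      f x v * partialX g i x v + g x v * partialX f i x v := by
  rw [partialX_eq ((hf.mul hg).differentiableAt hΩ hx),
    bundleDeriv_mul (hf.differentiableAt hΩ hx) (hg.differentiableAt hΩ hx),
    partialX_eq (hf.differentiableAt hΩ hx), partialX_eq (hg.differentiableAt hΩ hx)]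

theorem partialV_sum {ι : Type*} {s : Finset ι} {F : ι → Euc n → Euc n → ℝ} (hΩ : IsOpen Ω)
    (hF : ∀ i ∈ s, BundleSmooth Ω (F i)) (hx : (x, v) ∈ Ω) (j : Fin n) :
    partialV (fun y w => ∑ i ∈ s, F i y w) j x v = ∑ i ∈ s, partialV (F i) j x v := by
  rw [partialV_eq ((BundleSmooth.sum hF).differentiableAt hΩ hx),
    bundleDeriv_sum fun i hi => (hF i hi).differentiableAt hΩ hx]
  exact Finset.sum_congr rfl fun i hi => (partialV_eq ((hF i hi).differentiableAt hΩ hx) j).symm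

theorem partialV_coord (hΩ : IsOpen Ω) (hx : (x, v) ∈ Ω) (i j : Fin n) :
    partialV (fun _ w => w i) j x v = if i = j then 1 else 0 := by
  rw [partialV_eq ((BundleSmooth.coord i).differentiableAt hΩ hx), bundleDeriv_coord]
  simp

theorem partialV_comm (hΩ : IsOpen Ω) (hf : BundleSmooth Ω f) (hx : (x, v) ∈ Ω) (i j : Fin n) :
    partialV (partialV f i) j x v = partialV (partialV f j) i x v := by
  rw [partialV_eq ((hf.partialV hΩ i).differentiableAt hΩ hx),
    partialV_eq ((hf.partialV hΩ j).differentiableAt hΩ hx),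
    bundleDeriv_congr hΩ (fun y w h => partialV_eq (hf.differentiableAt hΩ h) i) hx,
    bundleDeriv_congr hΩ (fun y w h => partialV_eq (hf.differentiableAt hΩ h) j) hx,
    bundleDeriv_comm hf hΩ hx]

theorem partialX_partialV (hΩ : IsOpen Ω) (hf : BundleSmooth Ω f) (hx : (x, v) ∈ Ω)
    (i j : Fin n) :
    partialX (partialV f i) j x v = partialV (partialX f j) i x v := by
  rw [partialX_eq ((hf.partialV hΩ i).differentiableAt hΩ hx),
    partialV_eq ((hf.partialX hΩ j).differentiableAt hΩ hx),
    bundleDeriv_congr hΩ (fun y w h => partialV_eq (hf.differentiableAt hΩ h) i) hx,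
    bundleDeriv_congr hΩ (fun y w h => partialX_eq (hf.differentiableAt hΩ h) j) hx,
    bundleDeriv_comm hf hΩ hx]

end BundleCalculus

/-! ### Connection coefficients of a metric satisfying Okada's identity. -/

section Okada

variable {n : ℕ} {D : Set (Euc n)} {F : Euc n → Euc n → ℝ} {x v : Euc n}

/-- The slit tangent bundle of `D`. -/
def slitBundle (D : Set (Euc n)) : Set (Euc n × Euc n) := D ×ˢ {v | v ≠ 0}

/-- Finsler structures on an open set satisfying the identity `∂F/∂xᵏ = F ∂F/∂vᵏ`. -/
structure IsOkadaMetric (D : Set (Euc n)) (F : Euc n → Euc n → ℝ) : Prop where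
  isOpen : IsOpen D
  finsler : IsFinslerStructure D F
  okada : ∀ x ∈ D, ∀ v, v ≠ 0 → ∀ k, partialX F k x v = F x v * partialV F k x v

theorem isOpen_slitBundle (hD : IsOpen D) : IsOpen (slitBundle D) :=
  hD.prod isOpen_ne

theorem fundTensor_eq_of_smooth (hD : IsOpen D) (hF : BundleSmooth (slitBundle D) F)
    (h : (x, v) ∈ slitBundle D) (i j : Fin n) :
    fundTensor F x v i j =
      partialV F i x v * partialV F j x v + F x v * partialV (partialV F i) j x v := by
  have hΩ := isOpen_slitBundle hD
  have e : ∀ y w, (y, w) ∈ slitBundle D →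
      partialV (fun y w => F y w ^ 2) j y w = (2 * F y w) * partialV F j y w := by
    intro y w h
    simp only [sq]
    rw [partialV_mul hΩ hF hF h]
    ring
  simp only [fundTensor, Matrix.of_apply]
  have s2 : BundleSmooth (slitBundle D) (fun y w => 2 * F y w) := (BundleSmooth.const 2).mul hF
  rw [partialV_congr hΩ e (s2.mul (hF.partialV hΩ j)) h,
    partialV_mul hΩ s2 (hF.partialV hΩ j) h,
    partialV_mul hΩ (BundleSmooth.const 2) hF h, partialV_comm hΩ hF h j i,
    partialV_eq (f := fun _ _ => (2 : ℝ)) (by fun_prop), bundleDeriv_const]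
  ring

theorem contDiffOn_matrix_det {E : Type*} [NormedAddCommGroup E] [NormedSpace ℝ E] {s : Set E}
    {A : E → Matrix (Fin n) (Fin n) ℝ} (hA : ∀ i j, ContDiffOn ℝ ∞ (fun p => A p i j) s) :
    ContDiffOn ℝ ∞ (fun p => (A p).det) s := by
  simp only [Matrix.det_apply']
  exact ContDiffOn.sum fun σ _ => contDiffOn_const.mul (contDiffOn_prod fun i _ => hA _ _)

namespace IsOkadaMetric

variable (hF : IsOkadaMetric D F)
include hF

theorem isOpen_slit : IsOpen (slitBundle D) := isOpen_slitBundle hF.isOpen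

theorem smooth : BundleSmooth (slitBundle D) F := hF.finsler.smooth

theorem smooth₁ (i : Fin n) : BundleSmooth (slitBundle D) (partialV F i) :=
  hF.smooth.partialV hF.isOpen_slit i

theorem smooth₂ (i j : Fin n) : BundleSmooth (slitBundle D) (partialV (partialV F i) j) :=
  (hF.smooth₁ i).partialV hF.isOpen_slit j

theorem symm₂ (h : (x, v) ∈ slitBundle D) (i j : Fin n) :
    partialV (partialV F i) j x v = partialV (partialV F j) i x v :=
  partialV_comm hF.isOpen_slit hF.smooth h i j

theorem symm₃ (h : (x, v) ∈ slitBundle D) (i j k : Fin n) :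
    partialV (partialV (partialV F i) j) k x v = partialV (partialV (partialV F j) i) k x v :=
  partialV_congr hF.isOpen_slit (fun _ _ h => hF.symm₂ h i j) (hF.smooth₂ j i) h k

theorem symm₃' (h : (x, v) ∈ slitBundle D) (i j k : Fin n) :
    partialV (partialV (partialV F i) j) k x v = partialV (partialV (partialV F i) k) j x v :=
  partialV_comm hF.isOpen_slit (hF.smooth₁ i) h j k

theorem partialX_F (h : (x, v) ∈ slitBundle D) (k : Fin n) :
    partialX F k x v = F x v * partialV F k x v :=
  hF.okada x h.1 v h.2 k

/-- Mixed derivatives commute, so this is Okada's identity differentiated in `vⁱ`. In this way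
horizontal derivatives are traded for vertical ones. -/
theorem partialX_partialV (h : (x, v) ∈ slitBundle D) (i k : Fin n) :
    partialX (partialV F i) k x v =
      F x v * partialV (partialV F k) i x v + partialV F k x v * partialV F i x v := by
  rw [FunkGeometry.partialX_partialV hF.isOpen_slit hF.smooth h,
    partialV_congr hF.isOpen_slit (fun _ _ h => hF.partialX_F h k)
      (hF.smooth.mul (hF.smooth₁ k)) h,
    partialV_mul hF.isOpen_slit hF.smooth (hF.smooth₁ k) h]

theorem partialX_partialV₂ (h : (x, v) ∈ slitBundle D) (i j k : Fin n) :
    partialX (partialV (partialV F i) j) k x v =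
      F x v * partialV (partialV (partialV F k) i) j x v
      + partialV (partialV F k) i x v * partialV F j x v
      + (partialV F k x v * partialV (partialV F i) j x v
      + partialV F i x v * partialV (partialV F k) j x v) := by
  rw [FunkGeometry.partialX_partialV hF.isOpen_slit (hF.smooth₁ i) h,
    partialV_congr hF.isOpen_slit (fun _ _ h => hF.partialX_partialV h i k)
      ((hF.smooth.mul (hF.smooth₂ k i)).add ((hF.smooth₁ k).mul (hF.smooth₁ i))) h,
    partialV_add hF.isOpen_slit (hF.smooth.mul (hF.smooth₂ k i))
      ((hF.smooth₁ k).mul (hF.smooth₁ i)) h,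
    partialV_mul hF.isOpen_slit hF.smooth (hF.smooth₂ k i) h,
    partialV_mul hF.isOpen_slit (hF.smooth₁ k) (hF.smooth₁ i) h]

/-! Euler's identities. -/

theorem euler₀ (h : (x, v) ∈ slitBundle D) : ∑ k, v k * partialV F k x v = F x v := by
  have hd := hF.smooth.differentiableAt hF.isOpen_slit h
  rw [sum_mul_partialV hd]
  have h1 : HasDerivAt (fun c : ℝ => (x, c • v)) ((0 : Euc n), v) 1 := by
    have := (hasDerivAt_const (1 : ℝ) x).prodMk ((hasDerivAt_id (1 : ℝ)).smul_const v)
    simpa using this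
  have h2 : HasDerivAt (fun c : ℝ => F x (c • v)) (bundleDeriv (0, v) F x v) 1 := by
    have hd' : HasFDerivAt (fun p : Euc n × Euc n => F p.1 p.2)
        (fderiv ℝ (fun p : Euc n × Euc n => F p.1 p.2) (x, v)) (x, (1 : ℝ) • v) := by
      simpa using hd.hasFDerivAt
    exact hd'.comp_hasDerivAt (1 : ℝ) h1
  have h3 : HasDerivAt (fun c : ℝ => c * F x v) (F x v) 1 := by
    simpa using (hasDerivAt_id (1 : ℝ)).mul_const (F x v)
  refine h2.unique (h3.congr_of_eventuallyEq ?_)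
  filter_upwards [lt_mem_nhds (zero_lt_one' ℝ)] with c hc
    using hF.finsler.homogeneous x h.1 v c hc

/-- Differentiate `euler₀` in `vⁱ`: the terms `∂F/∂vⁱ` on the two sides cancel. -/
theorem euler₁ (h : (x, v) ∈ slitBundle D) (i : Fin n) :
    ∑ k, v k * partialV (partialV F i) k x v = 0 := by
  have e := partialV_congr hF.isOpen_slit (fun _ _ h => hF.euler₀ h) hF.smooth h i
  rw [partialV_sum hF.isOpen_slit (fun k _ => (BundleSmooth.coord k).mul (hF.smooth₁ k)) h] at e
  simp only [partialV_mul hF.isOpen_slit (BundleSmooth.coord _) (hF.smooth₁ _) h,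
    partialV_coord hF.isOpen_slit h, Finset.sum_add_distrib, mul_ite, mul_one, mul_zero,
    Finset.sum_ite_eq', Finset.mem_univ, if_true] at e
  simp only [hF.symm₂ h _ i] at e
  linarith

theorem euler₂ (h : (x, v) ∈ slitBundle D) (i j : Fin n) :
    ∑ k, v k * partialV (partialV (partialV F i) j) k x v = -partialV (partialV F i) j x v := by
  have e := partialV_congr hF.isOpen_slit (fun _ _ h => hF.euler₁ h i) (BundleSmooth.const 0) h j
  rw [partialV_sum hF.isOpen_slit (fun k _ => (BundleSmooth.coord k).mul (hF.smooth₂ i k)) h,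
    partialV_eq (by fun_prop), bundleDeriv_const] at e
  simp only [partialV_mul hF.isOpen_slit (BundleSmooth.coord _) (hF.smooth₂ i _) h,
    partialV_coord hF.isOpen_slit h, Finset.sum_add_distrib, mul_ite, mul_one, mul_zero,
    Finset.sum_ite_eq', Finset.mem_univ, if_true, hF.symm₃' h i _ j] at e
  linarith

/-! The fundamental tensor and its derivatives. -/

theorem fundTensor_eq (h : (x, v) ∈ slitBundle D) (i j : Fin n) :
    fundTensor F x v i j =
      partialV F i x v * partialV F j x v + F x v * partialV (partialV F i) j x v :=
  fundTensor_eq_of_smooth hF.isOpen hF.smooth h i j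

theorem fundTensor_formula_smooth (i j : Fin n) : BundleSmooth (slitBundle D) (fun y w =>
    partialV F i y w * partialV F j y w + F y w * partialV (partialV F i) j y w) :=
  ((hF.smooth₁ i).mul (hF.smooth₁ j)).add (hF.smooth.mul (hF.smooth₂ i j))

theorem fundTensor_smooth (i j : Fin n) :
    BundleSmooth (slitBundle D) (fun y w => fundTensor F y w i j) :=
  (hF.fundTensor_formula_smooth i j).congr fun _ _ h => hF.fundTensor_eq h i j

/-- The point of this form is its symmetry in all of `i`, `j`, `k`, which collapses every
Christoffel-type combination to a single term. -/
theorem partialX_fundTensor (h : (x, v) ∈ slitBundle D) (i j k : Fin n) :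
    partialX (fun y w => fundTensor F y w i j) k x v =
      2 * partialV F i x v * partialV F j x v * partialV F k x v
      + 2 * F x v * (partialV (partialV F i) j x v * partialV F k x v
        + partialV (partialV F i) k x v * partialV F j x v
        + partialV (partialV F j) k x v * partialV F i x v)
      + F x v ^ 2 * partialV (partialV (partialV F i) j) k x v := by
  rw [partialX_congr hF.isOpen_slit (fun _ _ h => hF.fundTensor_eq h i j)
      (hF.fundTensor_formula_smooth i j) h,
    partialX_add hF.isOpen_slit ((hF.smooth₁ i).mul (hF.smooth₁ j))
      (hF.smooth.mul (hF.smooth₂ i j)) h,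
    partialX_mul hF.isOpen_slit (hF.smooth₁ i) (hF.smooth₁ j) h,
    partialX_mul hF.isOpen_slit hF.smooth (hF.smooth₂ i j) h,
    hF.partialX_F h, hF.partialX_partialV h, hF.partialX_partialV h, hF.partialX_partialV₂ h,
    hF.symm₂ h k i, hF.symm₂ h k j, hF.symm₃ h k i j, hF.symm₃' h i k j]
  ring

theorem cartan_eq (h : (x, v) ∈ slitBundle D) (i j k : Fin n) :
    cartan F i j k x v = (1 / 2) * (partialV (partialV F i) k x v * partialV F j x v
      + partialV F i x v * partialV (partialV F j) k x v
      + partialV F k x v * partialV (partialV F i) j x v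
      + F x v * partialV (partialV (partialV F i) j) k x v) := by
  rw [cartan, partialV_congr hF.isOpen_slit (fun _ _ h => hF.fundTensor_eq h i j)
      (hF.fundTensor_formula_smooth i j) h,
    partialV_add hF.isOpen_slit ((hF.smooth₁ i).mul (hF.smooth₁ j))
      (hF.smooth.mul (hF.smooth₂ i j)) h,
    partialV_mul hF.isOpen_slit (hF.smooth₁ i) (hF.smooth₁ j) h,
    partialV_mul hF.isOpen_slit hF.smooth (hF.smooth₂ i j) h]
  ring

theorem cartan_swap (h : (x, v) ∈ slitBundle D) (i j k : Fin n) :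
    cartan F i j k x v = cartan F i k j x v := by
  rw [hF.cartan_eq h, hF.cartan_eq h, hF.symm₂ h j k, hF.symm₃' h i j k]
  ring

theorem cartan_symm (h : (x, v) ∈ slitBundle D) (i j k : Fin n) :
    cartan F i j k x v = cartan F j i k x v := by
  rw [hF.cartan_eq h, hF.cartan_eq h, hF.symm₂ h i j, hF.symm₃ h i j k]
  ring

/-- Infinitesimal form of the `0`-homogeneity of `g` in `v`. -/
theorem cartan_contract (h : (x, v) ∈ slitBundle D) (i j : Fin n) :
    ∑ k, cartan F i j k x v * v k = 0 := by
  have e0 := hF.euler₀ h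
  have e1 := hF.euler₁ h i
  have e1' := hF.euler₁ h j
  have e2 := hF.euler₂ h i j
  calc ∑ k, cartan F i j k x v * v k
      = (1 / 2) * (partialV F j x v * (∑ k, v k * partialV (partialV F i) k x v)
        + partialV F i x v * (∑ k, v k * partialV (partialV F j) k x v)
        + partialV (partialV F i) j x v * (∑ k, v k * partialV F k x v)
        + F x v * (∑ k, v k * partialV (partialV (partialV F i) j) k x v)) := by
        simp only [hF.cartan_eq h, Finset.mul_sum, ← Finset.sum_add_distrib]
        exact Finset.sum_congr rfl fun k _ => by ring
    _ = 0 := by rw [e0, e1, e1', e2]; ring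

theorem partialX_fundTensor_swap (h : (x, v) ∈ slitBundle D) (i j k : Fin n) :
    partialX (fun y w => fundTensor F y w i j) k x v =
      partialX (fun y w => fundTensor F y w i k) j x v := by
  rw [hF.partialX_fundTensor h, hF.partialX_fundTensor h, hF.symm₂ h j k, hF.symm₃' h i j k]
  ring

theorem partialX_fundTensor_symm (h : (x, v) ∈ slitBundle D) (i j k : Fin n) :
    partialX (fun y w => fundTensor F y w i j) k x v =
      partialX (fun y w => fundTensor F y w j i) k x v := by
  rw [hF.partialX_fundTensor h, hF.partialX_fundTensor h, hF.symm₂ h i j, hF.symm₃ h i j k]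
  ring

/-- This contraction determines both the nonlinear connection and the derivative of `det g` along
geodesics. -/
theorem partialX_fundTensor_contract (h : (x, v) ∈ slitBundle D) (i j : Fin n) :
    ∑ k, partialX (fun y w => fundTensor F y w i j) k x v * v k =
      F x v * (fundTensor F x v i j + partialV F i x v * partialV F j x v) := by
  have e0 := hF.euler₀ h
  have e1 := hF.euler₁ h i
  have e1' := hF.euler₁ h j
  have e2 := hF.euler₂ h i j
  calc ∑ k, partialX (fun y w => fundTensor F y w i j) k x v * v k
      = (2 * partialV F i x v * partialV F j x v + 2 * F x v * partialV (partialV F i) j x v)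
          * (∑ k, v k * partialV F k x v)
        + 2 * F x v * partialV F j x v * (∑ k, v k * partialV (partialV F i) k x v)
        + 2 * F x v * partialV F i x v * (∑ k, v k * partialV (partialV F j) k x v)
        + F x v ^ 2 * (∑ k, v k * partialV (partialV (partialV F i) j) k x v) := by
        simp only [hF.partialX_fundTensor h, Finset.mul_sum, ← Finset.sum_add_distrib]
        exact Finset.sum_congr rfl fun k _ => by ring
    _ = _ := by rw [e0, e1, e1', e2, hF.fundTensor_eq h]; ring

/-! The inverse of the fundamental tensor. -/

theorem isUnit_det (h : (x, v) ∈ slitBundle D) : IsUnit (fundTensor F x v).det :=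
  (hF.finsler.strongConvex x h.1 v h.2).det_pos.ne'.isUnit

theorem fundTensor_det_smooth :
    BundleSmooth (slitBundle D) (fun y w => (fundTensor F y w).det) :=
  contDiffOn_matrix_det hF.fundTensor_smooth

theorem inv_mul_fundTensor (h : (x, v) ∈ slitBundle D) (i j : Fin n) :
    ∑ s, fundTensorInv F x v i s * fundTensor F x v s j = if i = j then 1 else 0 := by
  have := congrFun (congrFun (Matrix.nonsing_inv_mul _ (hF.isUnit_det h)) i) j
  rwa [Matrix.mul_apply, Matrix.one_apply] at this

theorem fundTensor_contract (h : (x, v) ∈ slitBundle D) (s : Fin n) :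
    ∑ j, fundTensor F x v s j * v j = F x v * partialV F s x v := by
  have e0 := hF.euler₀ h
  have e1 := hF.euler₁ h s
  calc ∑ j, fundTensor F x v s j * v j
      = partialV F s x v * (∑ k, v k * partialV F k x v)
        + F x v * (∑ k, v k * partialV (partialV F s) k x v) := by
        simp only [hF.fundTensor_eq h, Finset.mul_sum, ← Finset.sum_add_distrib]
        exact Finset.sum_congr rfl fun k _ => by ring
    _ = _ := by rw [e0, e1]; ring

/-- The covector `F ∂F/∂vˢ` is `g_v(v, ·)`, so raising its index returns `v`. -/
theorem inv_contract (h : (x, v) ∈ slitBundle D) (i : Fin n) :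
    ∑ s, fundTensorInv F x v i s * (F x v * partialV F s x v) = v i := by
  simp only [← hF.fundTensor_contract h, Finset.mul_sum]
  rw [Finset.sum_comm]
  simp only [← mul_assoc, ← Finset.sum_mul, hF.inv_mul_fundTensor h]
  simp

theorem fundTensorInv_smooth (i j : Fin n) :
    BundleSmooth (slitBundle D) (fun y w => fundTensorInv F y w i j) := by
  intro p hp
  have hg : ∀ i j, ContDiffOn ℝ ∞ (fun p : Euc n × Euc n => fundTensor F p.1 p.2 i j)
      (slitBundle D) := hF.fundTensor_smooth
  have e : ∀ p : Euc n × Euc n, fundTensorInv F p.1 p.2 i j =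
      (fundTensor F p.1 p.2).det⁻¹ * (fundTensor F p.1 p.2).adjugate i j := by
    intro p
    simp [fundTensorInv, Matrix.inv_def]
  simp only [e]
  refine ContDiffWithinAt.mul (ContDiffWithinAt.inv (contDiffOn_matrix_det hg p hp) ?_) ?_
  · exact (hF.isUnit_det hp).ne_zero
  · simp only [Matrix.adjugate_apply]
    refine contDiffOn_matrix_det (A := fun p : Euc n × Euc n =>
      (fundTensor F p.1 p.2).updateRow j (Pi.single i 1)) (fun k l => ?_) p hp
    simp only [Matrix.updateRow_apply]
    split_ifs
    · exact contDiffOn_const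
    · exact hg k l

/-! The nonlinear connection and the Chern connection. -/

/-- By total symmetry the three derivatives of `g` are equal, and the signs `+, -, +` leave one of
them. -/
theorem formalChristoffel_eq (h : (x, v) ∈ slitBundle D) (i j k : Fin n) :
    formalChristoffel F i j k x v = (1 / 2) * ∑ s, fundTensorInv F x v i s *
      partialX (fun y w => fundTensor F y w s j) k x v := by
  rw [formalChristoffel]
  congr 1
  refine Finset.sum_congr rfl fun s _ => ?_
  congr 1
  rw [hF.partialX_fundTensor_swap h j k s, hF.partialX_fundTensor_symm h j s k,
    hF.partialX_fundTensor_swap h k s j, hF.partialX_fundTensor_symm h k j s,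
    hF.partialX_fundTensor_swap h j k s, hF.partialX_fundTensor_symm h j s k]
  ring

theorem half_inv_mul (h : (x, v) ∈ slitBundle D) (i j : Fin n) :
    (1 / 2) * ∑ s, fundTensorInv F x v i s *
      (F x v * (fundTensor F x v s j + partialV F s x v * partialV F j x v)) =
      (1 / 2) * (F x v * (if i = j then 1 else 0) + v i * partialV F j x v) := by
  rw [← hF.inv_mul_fundTensor h i j]
  nth_rewrite 1 [← hF.inv_contract h i]
  simp only [Finset.mul_sum, Finset.sum_mul, ← Finset.sum_add_distrib]
  exact Finset.sum_congr rfl fun s _ => by ring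

theorem formalChristoffel_contract (h : (x, v) ∈ slitBundle D) (i j : Fin n) :
    ∑ k, formalChristoffel F i j k x v * v k =
      (1 / 2) * (F x v * (if i = j then 1 else 0) + v i * partialV F j x v) := by
  rw [← hF.half_inv_mul h]
  simp only [← hF.partialX_fundTensor_contract h, hF.formalChristoffel_eq h, Finset.mul_sum,
    Finset.sum_mul]
  rw [Finset.sum_comm]
  exact Finset.sum_congr rfl fun s _ => Finset.sum_congr rfl fun k _ => by ring

theorem half_contract (h : (x, v) ∈ slitBundle D) (i : Fin n) :
    ∑ j, (1 / 2) * (F x v * (if i = j then 1 else 0) + v i * partialV F j x v) * v j =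
      F x v * v i := by
  have e : ∀ j, (1 / 2) * (F x v * (if i = j then 1 else 0) + v i * partialV F j x v) * v j =
      (1 / 2) * ((F x v * if i = j then v j else 0) + v i * (v j * partialV F j x v)) := by
    intro j
    split_ifs <;> ring
  simp only [e, ← Finset.mul_sum, Finset.sum_add_distrib, hF.euler₀ h, Finset.sum_ite_eq,
    Finset.mem_univ, if_true]
  ring

/-- The spray `γᵏ_{rs} vʳ vˢ` equals `F vᵏ`. Being proportional to `v`, it is annihilated by the
Cartan tensor, so the correction term in `N` vanishes. -/
theorem nonlinearConn_eq (h : (x, v) ∈ slitBundle D) (i j : Fin n) :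
    nonlinearConn F i j x v =
      (1 / 2) * (F x v * (if i = j then 1 else 0) + v i * partialV F j x v) := by
  have e : ∀ k, ∑ r, ∑ s, formalChristoffel F k r s x v * v r * v s = F x v * v k := by
    intro k
    rw [← hF.half_contract h k]
    refine Finset.sum_congr rfl fun r _ => ?_
    rw [← hF.formalChristoffel_contract h k r, Finset.sum_mul]
    exact Finset.sum_congr rfl fun s _ => by ring
  have z : ∑ k, (∑ l, fundTensorInv F x v i l * cartan F l j k x v) * (F x v * v k) = 0 := by
    simp only [Finset.sum_mul]
    rw [Finset.sum_comm]
    refine Finset.sum_eq_zero fun l _ => ?_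
    calc _ = fundTensorInv F x v i l * F x v * ∑ k, cartan F l j k x v * v k := by
          rw [Finset.mul_sum]
          exact Finset.sum_congr rfl fun k _ => by ring
      _ = 0 := by rw [hF.cartan_contract h, mul_zero]
  rw [nonlinearConn, hF.formalChristoffel_contract h]
  simp only [e, z, sub_zero]

theorem nonlinearConn_formula_smooth (i j : Fin n) : BundleSmooth (slitBundle D) (fun y w =>
    (1 / 2) * (F y w * (if i = j then 1 else 0) + w i * partialV F j y w)) :=
  (BundleSmooth.const (1 / 2)).mul ((hF.smooth.mul (BundleSmooth.const _)).add
    ((BundleSmooth.coord i).mul (hF.smooth₁ j)))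

theorem nonlinearConn_smooth (i j : Fin n) : BundleSmooth (slitBundle D) (nonlinearConn F i j) :=
  (hF.nonlinearConn_formula_smooth i j).congr fun _ _ h => hF.nonlinearConn_eq h i j

theorem nonlinearConn_contract (h : (x, v) ∈ slitBundle D) (i : Fin n) :
    ∑ j, nonlinearConn F i j x v * v j = F x v * v i := by
  simp only [hF.nonlinearConn_eq h, hF.half_contract h]

/-- In `N`, the part proportional to `vⁱ` is killed by the Cartan tensor; only `F/2` times the
identity acts, on `∂g/∂v = 2C`. -/
theorem horizDeriv_fundTensor (h : (x, v) ∈ slitBundle D) (i j k : Fin n) :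
    horizDeriv F (fun y w => fundTensor F y w i j) k x v =
      partialX (fun y w => fundTensor F y w i j) k x v - F x v * cartan F i j k x v := by
  have e : ∀ l, partialV (fun y w => fundTensor F y w i j) l x v = 2 * cartan F i j l x v := by
    intro l
    rw [cartan]
    ring
  have c := hF.cartan_contract h i j
  rw [horizDeriv]
  simp only [e, hF.nonlinearConn_eq h]
  congr 1
  have e2 : ∀ l, (1 / 2) * (F x v * (if l = k then 1 else 0) + v l * partialV F k x v) *
      (2 * cartan F i j l x v) = (F x v * if l = k then cartan F i j l x v else 0)
        + partialV F k x v * (cartan F i j l x v * v l) := by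
    intro l
    split_ifs <;> ring
  simp only [e2, Finset.sum_add_distrib, ← Finset.mul_sum, c, Finset.sum_ite_eq',
    Finset.mem_univ, if_true, mul_zero, add_zero]

/-- The correction `F C` is also totally symmetric, so the same collapse occurs as for the formal
Christoffel symbols. -/
theorem chernConn_eq (h : (x, v) ∈ slitBundle D) (i j k : Fin n) :
    chernConn F i j k x v = (1 / 2) * ∑ s, fundTensorInv F x v i s *
      (partialX (fun y w => fundTensor F y w s j) k x v - F x v * cartan F s j k x v) := by
  rw [chernConn]
  congr 1
  refine Finset.sum_congr rfl fun s _ => ?_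
  simp only [hF.horizDeriv_fundTensor h]
  rw [hF.partialX_fundTensor_swap h j k s, hF.partialX_fundTensor_symm h j s k,
    hF.partialX_fundTensor_swap h k s j, hF.partialX_fundTensor_symm h k j s,
    hF.partialX_fundTensor_swap h j k s, hF.partialX_fundTensor_symm h j s k,
    hF.cartan_swap h j k s, hF.cartan_symm h j s k, hF.cartan_swap h k s j,
    hF.cartan_symm h k j s, hF.cartan_swap h j k s, hF.cartan_symm h j s k]
  ring

theorem chernConn_symm (h : (x, v) ∈ slitBundle D) (i j k : Fin n) :
    chernConn F i j k x v = chernConn F i k j x v := by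
  rw [hF.chernConn_eq h, hF.chernConn_eq h]
  simp only [hF.partialX_fundTensor_swap h _ j k, hF.cartan_swap h _ j k]

theorem cartan_smooth (i j k : Fin n) : BundleSmooth (slitBundle D) (cartan F i j k) :=
  (BundleSmooth.const _).mul ((hF.fundTensor_smooth i j).partialV hF.isOpen_slit k)

theorem chernConn_smooth (i j k : Fin n) : BundleSmooth (slitBundle D) (chernConn F i j k) := by
  refine BundleSmooth.congr ?_ fun _ _ h => hF.chernConn_eq h i j k
  exact (BundleSmooth.const _).mul (BundleSmooth.sum fun s _ => (hF.fundTensorInv_smooth i s).mul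
    (((hF.fundTensor_smooth s j).partialX hF.isOpen_slit k).sub
      (hF.smooth.mul (hF.cartan_smooth s j k))))

theorem chernConn_contract (h : (x, v) ∈ slitBundle D) (i j : Fin n) :
    ∑ k, chernConn F i j k x v * v k = nonlinearConn F i j x v := by
  rw [hF.nonlinearConn_eq h, ← hF.formalChristoffel_contract h]
  calc ∑ k, chernConn F i j k x v * v k
      = ∑ k, formalChristoffel F i j k x v * v k - (1 / 2) * F x v *
          ∑ s, fundTensorInv F x v i s * ∑ k, cartan F s j k x v * v k := by
        simp only [hF.chernConn_eq h, hF.formalChristoffel_eq h, Finset.mul_sum, Finset.sum_mul]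
        rw [Finset.sum_comm (f := fun s k => 1 / 2 * F x v *
          (fundTensorInv F x v i s * (cartan F s j k x v * v k))), ← Finset.sum_sub_distrib]
        refine Finset.sum_congr rfl fun k _ => ?_
        rw [← Finset.sum_sub_distrib]
        exact Finset.sum_congr rfl fun s _ => by ring
    _ = _ := by simp only [hF.cartan_contract h]; simp

end IsOkadaMetric

end Okada

/-! ### Riemann and Ricci curvature from Okada's identity. -/

section Curvature

variable {n : ℕ} {D : Set (Euc n)} {F f g : Euc n → Euc n → ℝ} {x v : Euc n}
  {Ω : Set (Euc n × Euc n)}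

/-- The horizontal lift of the `k`-th coordinate vector. -/
noncomputable def horizDir (F : Euc n → Euc n → ℝ) (k : Fin n) (x v : Euc n) : Euc n × Euc n :=
  (EuclideanSpace.single k 1, -(WithLp.toLp 2 fun i => nonlinearConn F i k x v))

/-- At each point `δ/δxᵏ` is a directional derivative along the horizontal lift, hence a derivation.
-/
theorem horizDeriv_eq_bundleDeriv
    (hf : DifferentiableAt ℝ (fun p : Euc n × Euc n => f p.1 p.2) (x, v)) (k : Fin n) :
    horizDeriv F f k x v = bundleDeriv (horizDir F k x v) f x v := by
  have h := sum_mul_partialV hf (WithLp.toLp 2 fun i => nonlinearConn F i k x v)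
  simp only at h
  rw [horizDeriv, h, partialX_eq hf, bundleDeriv, bundleDeriv, bundleDeriv, ← map_sub]
  simp [horizDir]

theorem horizDeriv_congr (hΩ : IsOpen Ω) (h : ∀ y w, (y, w) ∈ Ω → f y w = g y w)
    (hg : BundleSmooth Ω g) (hx : (x, v) ∈ Ω) (k : Fin n) :
    horizDeriv F f k x v = horizDeriv F g k x v := by
  rw [horizDeriv_eq_bundleDeriv ((hg.congr h).differentiableAt hΩ hx),
    horizDeriv_eq_bundleDeriv (hg.differentiableAt hΩ hx), bundleDeriv_congr hΩ h hx]

theorem horizDeriv_add (hΩ : IsOpen Ω) (hf : BundleSmooth Ω f) (hg : BundleSmooth Ω g)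
    (hx : (x, v) ∈ Ω) (k : Fin n) :
    horizDeriv F (fun y w => f y w + g y w) k x v
      = horizDeriv F f k x v + horizDeriv F g k x v := by
  rw [horizDeriv_eq_bundleDeriv ((hf.add hg).differentiableAt hΩ hx),
    bundleDeriv_add (hf.differentiableAt hΩ hx) (hg.differentiableAt hΩ hx),
    horizDeriv_eq_bundleDeriv (hf.differentiableAt hΩ hx),
    horizDeriv_eq_bundleDeriv (hg.differentiableAt hΩ hx)]

theorem horizDeriv_mul (hΩ : IsOpen Ω) (hf : BundleSmooth Ω f) (hg : BundleSmooth Ω g)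
    (hx : (x, v) ∈ Ω) (k : Fin n) :
    horizDeriv F (fun y w => f y w * g y w) k x v =
      f x v * horizDeriv F g k x v + g x v * horizDeriv F f k x v := by
  rw [horizDeriv_eq_bundleDeriv ((hf.mul hg).differentiableAt hΩ hx),
    bundleDeriv_mul (hf.differentiableAt hΩ hx) (hg.differentiableAt hΩ hx),
    horizDeriv_eq_bundleDeriv (hf.differentiableAt hΩ hx),
    horizDeriv_eq_bundleDeriv (hg.differentiableAt hΩ hx)]

theorem horizDeriv_sum {ι : Type*} {s : Finset ι} {G : ι → Euc n → Euc n → ℝ} (hΩ : IsOpen Ω)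
    (hG : ∀ i ∈ s, BundleSmooth Ω (G i)) (hx : (x, v) ∈ Ω) (k : Fin n) :
    horizDeriv F (fun y w => ∑ i ∈ s, G i y w) k x v = ∑ i ∈ s, horizDeriv F (G i) k x v := by
  rw [horizDeriv_eq_bundleDeriv ((BundleSmooth.sum hG).differentiableAt hΩ hx),
    bundleDeriv_sum fun i hi => (hG i hi).differentiableAt hΩ hx]
  exact Finset.sum_congr rfl fun i hi =>
    (horizDeriv_eq_bundleDeriv ((hG i hi).differentiableAt hΩ hx) k).symm

theorem horizDeriv_coord (i k : Fin n) :
    horizDeriv F (fun _ w => w i) k x v = -nonlinearConn F i k x v := by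
  rw [horizDeriv_eq_bundleDeriv ((BundleSmooth.coord (Ω := Set.univ) i).differentiableAt
    isOpen_univ (Set.mem_univ _)), bundleDeriv_coord]
  rfl

theorem horizDeriv_const (c : ℝ) (k : Fin n) :
    horizDeriv F (fun _ _ => c) k x v = 0 := by
  rw [horizDeriv_eq_bundleDeriv (by fun_prop), bundleDeriv_const]

namespace IsOkadaMetric

variable (hF : IsOkadaMetric D F)
include hF

/-- By Euler's identity `Nⁱ_k ∂F/∂vⁱ = F ∂F/∂vᵏ`, which is `∂F/∂xᵏ` by Okada's identity. -/
theorem horizDeriv_self (h : (x, v) ∈ slitBundle D) (k : Fin n) : horizDeriv F F k x v = 0 := by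
  have e : ∀ i, (1 / 2) * (F x v * (if i = k then 1 else 0) + v i * partialV F k x v) *
      partialV F i x v = (1 / 2) * ((F x v * if i = k then partialV F i x v else 0)
        + partialV F k x v * (v i * partialV F i x v)) := by
    intro i
    split_ifs <;> ring
  rw [horizDeriv, hF.partialX_F h]
  simp only [hF.nonlinearConn_eq h, e, ← Finset.mul_sum, Finset.sum_add_distrib, hF.euler₀ h,
    Finset.sum_ite_eq', Finset.mem_univ, if_true]
  ring

theorem sum_horizDeriv_partialV (h : (x, v) ∈ slitBundle D) (k : Fin n) :
    ∑ l, v l * horizDeriv F (partialV F k) l x v = F x v * partialV F k x v := by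
  have e1 : ∑ l, v l * partialX (partialV F k) l x v = F x v * partialV F k x v := by
    calc _ = F x v * ∑ l, v l * partialV (partialV F k) l x v
          + partialV F k x v * ∑ l, v l * partialV F l x v := by
          simp only [hF.partialX_partialV h, hF.symm₂ h _ k, Finset.mul_sum,
            ← Finset.sum_add_distrib]
          exact Finset.sum_congr rfl fun _ _ => by ring
      _ = _ := by rw [hF.euler₁ h, hF.euler₀ h]; ring
  have e2 : ∑ l, v l * ∑ i, nonlinearConn F i l x v * partialV (partialV F k) i x v = 0 := by
    calc _ = ∑ i, (∑ l, nonlinearConn F i l x v * v l) * partialV (partialV F k) i x v := by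
          simp only [Finset.mul_sum, Finset.sum_mul]
          rw [Finset.sum_comm]
          exact Finset.sum_congr rfl fun _ _ => Finset.sum_congr rfl fun _ _ => by ring
      _ = F x v * ∑ i, v i * partialV (partialV F k) i x v := by
          simp only [hF.nonlinearConn_contract h, Finset.mul_sum, mul_assoc]
      _ = 0 := by rw [hF.euler₁ h, mul_zero]
  simp only [horizDeriv, mul_sub, Finset.sum_sub_distrib, e1, e2, sub_zero]

theorem horizDeriv_nonlinearConn (h : (x, v) ∈ slitBundle D) (i k l : Fin n) :
    horizDeriv F (nonlinearConn F i k) l x v =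
      (1 / 2) * (v i * horizDeriv F (partialV F k) l x v
        - partialV F k x v * nonlinearConn F i l x v) := by
  have s1 := hF.smooth.mul (BundleSmooth.const (Ω := slitBundle D) (if i = k then 1 else 0))
  have s2 := (BundleSmooth.coord i).mul (hF.smooth₁ k)
  rw [horizDeriv_congr hF.isOpen_slit (fun _ _ h => hF.nonlinearConn_eq h i k)
      (hF.nonlinearConn_formula_smooth i k) h,
    horizDeriv_mul hF.isOpen_slit (BundleSmooth.const _) (s1.add s2) h,
    horizDeriv_add hF.isOpen_slit s1 s2 h,
    horizDeriv_mul hF.isOpen_slit hF.smooth (BundleSmooth.const _) h,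
    horizDeriv_mul hF.isOpen_slit (BundleSmooth.coord i) (hF.smooth₁ k) h,
    horizDeriv_const, horizDeriv_const, horizDeriv_self hF h, horizDeriv_coord]
  ring

/-- Since `F` is horizontally constant, only `vⁱ ∂F/∂vᵏ` is differentiated. Contraction with `v`
produces `F vⁱ ∂F/∂vᵏ` twice, with opposite signs. -/
theorem sum_horizDeriv_nonlinearConn (h : (x, v) ∈ slitBundle D) (i k : Fin n) :
    ∑ l, v l * horizDeriv F (nonlinearConn F i k) l x v = 0 := by
  have e1 := hF.sum_horizDeriv_partialV h k
  have e2 := hF.nonlinearConn_contract h i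
  calc _ = (1 / 2) * (v i * (∑ l, v l * horizDeriv F (partialV F k) l x v)
        - partialV F k x v * (∑ l, nonlinearConn F i l x v * v l)) := by
        simp only [hF.horizDeriv_nonlinearConn h, Finset.mul_sum, ← Finset.sum_sub_distrib]
        exact Finset.sum_congr rfl fun _ _ => by ring
    _ = 0 := by rw [e1, e2]; ring

/-- Leibniz rule for `Γⁱ_{jl} vˡ = Nⁱ_j`; the extra term comes from `δvˡ/δxᵏ = -Nˡ_k`. -/
theorem sum_horizDeriv_chernConn (h : (x, v) ∈ slitBundle D) (i j k : Fin n) :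
    ∑ l, horizDeriv F (chernConn F i j l) k x v * v l =
      horizDeriv F (nonlinearConn F i j) k x v
        + ∑ l, chernConn F i j l x v * nonlinearConn F l k x v := by
  have s : ∀ l ∈ Finset.univ, BundleSmooth (slitBundle D) (fun y w => chernConn F i j l y w * w l) :=
    fun l _ => (hF.chernConn_smooth i j l).mul (BundleSmooth.coord l)
  rw [← horizDeriv_congr hF.isOpen_slit (fun _ _ h => hF.chernConn_contract h i j)
      (hF.nonlinearConn_smooth i j) h, horizDeriv_sum hF.isOpen_slit s h,
    ← Finset.sum_add_distrib]
  refine Finset.sum_congr rfl fun l _ => ?_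
  rw [horizDeriv_mul hF.isOpen_slit (hF.chernConn_smooth i j l) (BundleSmooth.coord l) h,
    horizDeriv_coord]
  ring

theorem sum_horizDeriv_nonlinearConn' (h : (x, v) ∈ slitBundle D) (i k : Fin n) :
    ∑ j, horizDeriv F (nonlinearConn F i j) k x v * v j =
      -F x v * nonlinearConn F i k x v
        + ∑ j, nonlinearConn F i j x v * nonlinearConn F j k x v := by
  have s : ∀ l ∈ Finset.univ, BundleSmooth (slitBundle D) (fun y w => nonlinearConn F i l y w * w l) :=
    fun l _ => (hF.nonlinearConn_smooth i l).mul (BundleSmooth.coord l)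
  have e : horizDeriv F (fun y w => F y w * w i) k x v = -F x v * nonlinearConn F i k x v := by
    rw [horizDeriv_mul hF.isOpen_slit hF.smooth (BundleSmooth.coord i) h, hF.horizDeriv_self h,
      horizDeriv_coord]
    ring
  rw [← e, ← horizDeriv_congr hF.isOpen_slit (fun _ _ h => hF.nonlinearConn_contract h i)
      (hF.smooth.mul (BundleSmooth.coord i)) h, horizDeriv_sum hF.isOpen_slit s h,
    ← Finset.sum_add_distrib]
  refine Finset.sum_congr rfl fun l _ => ?_
  rw [horizDeriv_mul hF.isOpen_slit (hF.nonlinearConn_smooth i l) (BundleSmooth.coord l) h,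
    horizDeriv_coord]
  ring

/-- Contracting with `v` twice eliminates `Γ` in favour of `N`. The four terms of the curvature
become `-F N + 2N²`, `F N`, `F N` and `N²`, entering with signs `+, -, +, -`. -/
theorem riemannCurvature_eq (h : (x, v) ∈ slitBundle D) (i k : Fin n) :
    riemannCurvature F x v i k = -F x v * nonlinearConn F i k x v
      + ∑ j, nonlinearConn F i j x v * nonlinearConn F j k x v := by
  have comm3 : ∀ G : Fin n → Fin n → Fin n → ℝ,
      ∑ j, ∑ l, ∑ a, G j l a = ∑ a, ∑ j, ∑ l, G j l a := by
    intro G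
    rw [Finset.sum_congr rfl fun j _ => Finset.sum_comm]
    exact Finset.sum_comm
  have c : ∀ a b, ∑ j, chernConn F a j b x v * v j = nonlinearConn F a b x v := by
    intro a b
    rw [← hF.chernConn_contract h]
    exact Finset.sum_congr rfl fun j _ => by rw [hF.chernConn_symm h]
  have e1 : ∑ j, ∑ l, v j * horizDeriv F (chernConn F i j l) k x v * v l =
      -F x v * nonlinearConn F i k x v
      + 2 * ∑ j, nonlinearConn F i j x v * nonlinearConn F j k x v := by
    calc _ = ∑ j, (horizDeriv F (nonlinearConn F i j) k x v * v j
          + ∑ l, (chernConn F i j l x v * v j) * nonlinearConn F l k x v) := by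
          refine Finset.sum_congr rfl fun j _ => ?_
          simp only [mul_assoc, ← Finset.mul_sum, hF.sum_horizDeriv_chernConn h]
          rw [mul_add, mul_comm, Finset.mul_sum]
          congr 1
          exact Finset.sum_congr rfl fun l _ => by ring
      _ = _ := by
          rw [Finset.sum_add_distrib, hF.sum_horizDeriv_nonlinearConn' h, Finset.sum_comm]
          simp only [← Finset.sum_mul, c]
          ring
  have e2 : ∑ j, ∑ l, v j * horizDeriv F (chernConn F i j k) l x v * v l =
      F x v * nonlinearConn F i k x v := by
    calc _ = ∑ l, v l * ∑ j, horizDeriv F (chernConn F i k j) l x v * v j := by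
          rw [Finset.sum_comm]
          refine Finset.sum_congr rfl fun l _ => ?_
          rw [Finset.mul_sum]
          refine Finset.sum_congr rfl fun j _ => ?_
          rw [horizDeriv_congr hF.isOpen_slit (fun _ _ h => hF.chernConn_symm h i j k)
            (hF.chernConn_smooth i k j) h]
          ring
      _ = ∑ j, chernConn F i k j x v * ∑ l, nonlinearConn F j l x v * v l := by
          simp only [hF.sum_horizDeriv_chernConn h, mul_add, Finset.sum_add_distrib,
            hF.sum_horizDeriv_nonlinearConn h, zero_add, Finset.mul_sum]
          rw [Finset.sum_comm]
          exact Finset.sum_congr rfl fun _ _ => Finset.sum_congr rfl fun _ _ => by ring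
      _ = F x v * ∑ j, chernConn F i k j x v * v j := by
          simp only [hF.nonlinearConn_contract h, Finset.mul_sum]
          exact Finset.sum_congr rfl fun _ _ => by ring
      _ = _ := by rw [hF.chernConn_contract h]
  have e3 : ∑ j, ∑ l, v j * (∑ a, chernConn F i a k x v * chernConn F a j l x v) * v l =
      F x v * nonlinearConn F i k x v := by
    calc _ = ∑ a, chernConn F i a k x v * ∑ j, (∑ l, chernConn F a j l x v * v l) * v j := by
          simp only [Finset.mul_sum, Finset.sum_mul]
          rw [comm3]
          refine Finset.sum_congr rfl fun _ _ => ?_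
          exact Finset.sum_congr rfl fun _ _ => Finset.sum_congr rfl fun _ _ => by ring
      _ = F x v * ∑ a, chernConn F i a k x v * v a := by
          simp only [hF.chernConn_contract h, hF.nonlinearConn_contract h, Finset.mul_sum]
          exact Finset.sum_congr rfl fun _ _ => by ring
      _ = _ := by rw [c]
  have e4 : ∑ j, ∑ l, v j * (∑ a, chernConn F i a l x v * chernConn F a j k x v) * v l =
      ∑ a, nonlinearConn F i a x v * nonlinearConn F a k x v := by
    calc _ = ∑ a, (∑ l, chernConn F i a l x v * v l) * (∑ j, chernConn F a j k x v * v j) := by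
          simp only [Finset.mul_sum, Finset.sum_mul]
          rw [comm3]
          refine Finset.sum_congr rfl fun _ _ => ?_
          exact Finset.sum_congr rfl fun _ _ => Finset.sum_congr rfl fun _ _ => by ring
      _ = _ := by simp only [hF.chernConn_contract h, c]
  have e : riemannCurvature F x v i k =
      ∑ j, ∑ l, v j * horizDeriv F (chernConn F i j l) k x v * v l
      - ∑ j, ∑ l, v j * horizDeriv F (chernConn F i j k) l x v * v l
      + (∑ j, ∑ l, v j * (∑ a, chernConn F i a k x v * chernConn F a j l x v) * v l
      - ∑ j, ∑ l, v j * (∑ a, chernConn F i a l x v * chernConn F a j k x v) * v l) := by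
    simp only [riemannCurvature, chernCurvature, Matrix.of_apply, ← Finset.sum_sub_distrib,
      ← Finset.sum_add_distrib]
    refine Finset.sum_congr rfl fun _ _ => Finset.sum_congr rfl fun _ _ => ?_
    rw [Finset.sum_sub_distrib]
    ring
  rw [e, e1, e2, e3, e4]
  ring

theorem ricci_eq (h : (x, v) ∈ slitBundle D) :
    ricci F x v = -((n : ℝ) - 1) / 4 * F x v ^ 2 := by
  have e : ∀ i, riemannCurvature F x v i i =
      -(1 / 4) * F x v ^ 2 + (1 / 4) * F x v * (v i * partialV F i x v) := by
    intro i
    have e1 : ∀ j, nonlinearConn F i j x v * nonlinearConn F j i x v =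
        (if i = j then (1 / 4) * F x v * (F x v + 2 * (v j * partialV F j x v)) else 0)
        + (1 / 4) * (v i * partialV F i x v) * (v j * partialV F j x v) := by
      intro j
      rw [hF.nonlinearConn_eq h, hF.nonlinearConn_eq h]
      by_cases hij : i = j
      · subst hij
        simp only [if_true]
        ring
      · simp only [hij, Ne.symm hij, if_false]
        ring
    rw [hF.riemannCurvature_eq h]
    simp only [e1, Finset.sum_add_distrib, ← Finset.mul_sum, hF.euler₀ h, Finset.sum_ite_eq,
      Finset.mem_univ, if_true]
    rw [hF.nonlinearConn_eq h, if_pos rfl]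
    ring
  simp only [ricci, Matrix.trace, Matrix.diag_apply, e, Finset.sum_add_distrib, ← Finset.mul_sum,
    hF.euler₀ h, Finset.sum_const, Finset.card_univ, Fintype.card_fin, nsmul_eq_mul]
  ring

end IsOkadaMetric

end Curvature

/-! ### The Funk metric as a gauge. -/

section Gauge

variable {n : ℕ} {D : Set (Euc n)} {x v : Euc n}

theorem IsStronglyConvexDomain.preimage_mem_nhds (hD : IsStronglyConvexDomain D) (hx : x ∈ D) :
    (x + ·) ⁻¹' D ∈ nhds (0 : Euc n) :=
  (hD.isOpen.preimage (continuous_const_add x)).mem_nhds (by simpa using hx)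

theorem IsStronglyConvexDomain.convex_preimage (hD : IsStronglyConvexDomain D) (x : Euc n) :
    Convex ℝ ((x + ·) ⁻¹' D) :=
  hD.convex.translate_preimage_right x

theorem IsStronglyConvexDomain.isBounded_preimage (hD : IsStronglyConvexDomain D) (x : Euc n) :
    Bornology.IsBounded ((x + ·) ⁻¹' D) := by
  obtain ⟨R, hR⟩ := hD.isBounded.subset_closedBall x
  refine (Metric.isBounded_closedBall (x := (0 : Euc n)) (r := R)).subset fun y hy => ?_
  simpa [dist_eq_norm] using hR hy

theorem IsStronglyConvexDomain.gauge_pos (hD : IsStronglyConvexDomain D) (hx : x ∈ D) :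
    0 < gauge ((x + ·) ⁻¹' D) v ↔ v ≠ 0 :=
  _root_.gauge_pos (absorbent_nhds_zero (hD.preimage_mem_nhds hx))
    (NormedSpace.isVonNBounded_of_isBounded ℝ (hD.isBounded_preimage x))

theorem IsStronglyConvexDomain.gauge_eq_one_iff (hD : IsStronglyConvexDomain D) (hx : x ∈ D) :
    gauge ((x + ·) ⁻¹' D) v = 1 ↔ x + v ∈ frontier D := by
  rw [gauge_eq_one_iff_mem_frontier (hD.convex_preimage x) (hD.preimage_mem_nhds hx)]
  have := (Homeomorph.addLeft x).preimage_frontier D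
  rw [Homeomorph.coe_addLeft] at this
  rw [← this]
  rfl

theorem funkMetric_zero : funkMetric D x 0 = 0 := by simp [funkMetric]

/-- Boundary points of `D - x` are exactly those of gauge `1`, so homogeneity leaves a single exit
time, the inverse of the gauge. Boundedness of `D` makes the gauge positive for `v ≠ 0`. -/
theorem IsStronglyConvexDomain.funkMetric_eq_gauge (hD : IsStronglyConvexDomain D) (hx : x ∈ D)
    (v : Euc n) : funkMetric D x v = gauge ((x + ·) ⁻¹' D) v := by
  rcases eq_or_ne v 0 with rfl | hv
  · rw [funkMetric_zero, gauge_zero]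
  have hg := (hD.gauge_pos hx).2 hv
  have e : {t : ℝ | 0 < t ∧ x + t • v ∈ frontier D} = {(gauge ((x + ·) ⁻¹' D) v)⁻¹} := by
    ext t
    simp only [Set.mem_ofPred_eq, Set.mem_singleton_iff]
    constructor
    · rintro ⟨ht, h⟩
      rw [← hD.gauge_eq_one_iff hx, gauge_smul_of_nonneg ht.le, smul_eq_mul] at h
      exact eq_inv_of_mul_eq_one_left h
    · rintro rfl
      refine ⟨inv_pos.2 hg, ?_⟩
      rw [← hD.gauge_eq_one_iff hx, gauge_smul_of_nonneg (inv_pos.2 hg).le, smul_eq_mul,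
        inv_mul_cancel₀ hg.ne']
  have hv' : ‖v‖ ≠ 0 := norm_ne_zero_iff.2 hv
  rw [funkMetric, exitTime, e, csInf_singleton, sub_add_cancel_left, norm_neg, norm_smul,
    Real.norm_of_nonneg (inv_pos.2 hg).le]
  field_simp

theorem IsStronglyConvexDomain.funkMetric_pos (hD : IsStronglyConvexDomain D) (hx : x ∈ D)
    (hv : v ≠ 0) : 0 < funkMetric D x v := by
  rw [hD.funkMetric_eq_gauge hx]
  exact (hD.gauge_pos hx).2 hv

theorem IsStronglyConvexDomain.funkMetric_smul (hD : IsStronglyConvexDomain D) (hx : x ∈ D)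
    (v : Euc n) {c : ℝ} (hc : 0 ≤ c) : funkMetric D x (c • v) = c * funkMetric D x v := by
  rw [hD.funkMetric_eq_gauge hx, hD.funkMetric_eq_gauge hx, gauge_smul_of_nonneg hc, smul_eq_mul]

theorem IsStronglyConvexDomain.funkMetric_eq_one_iff (hD : IsStronglyConvexDomain D)
    (hx : x ∈ D) : funkMetric D x v = 1 ↔ x + v ∈ frontier D := by
  rw [hD.funkMetric_eq_gauge hx, hD.gauge_eq_one_iff hx]

theorem IsStronglyConvexDomain.funkMetric_eq_inv (hD : IsStronglyConvexDomain D) (hx : x ∈ D)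
    {t : ℝ} (ht : 0 < t) (h : x + t • v ∈ frontier D) : funkMetric D x v = t⁻¹ := by
  rw [← hD.funkMetric_eq_one_iff hx, hD.funkMetric_smul hx _ ht.le] at h
  exact eq_inv_of_mul_eq_one_right h

theorem IsStronglyConvexDomain.exit_mem_frontier (hD : IsStronglyConvexDomain D) (hx : x ∈ D)
    (hv : v ≠ 0) : x + (funkMetric D x v)⁻¹ • v ∈ frontier D := by
  have h := hD.funkMetric_pos hx hv
  rw [← hD.funkMetric_eq_one_iff hx, hD.funkMetric_smul hx _ (inv_pos.2 h).le,
    inv_mul_cancel₀ h.ne']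

end Gauge

/-! ### Supporting hyperplanes and strict convexity. -/

section Boundary

variable {n : ℕ} {D U : Set (Euc n)} {ρ : Euc n → ℝ} {b : Euc n}

/-- A local defining function `ρ` on `U` of `D` at the boundary point `b`, positively curved. -/
structure IsDefiningFunction (D U : Set (Euc n)) (ρ : Euc n → ℝ) (b : Euc n) : Prop where
  isOpen : IsOpen U
  mem : b ∈ U
  mem_frontier : b ∈ frontier D
  smooth : ContDiffOn ℝ ∞ ρ U
  inter_eq : D ∩ U = {y | ρ y < 0} ∩ U
  fderiv_ne : fderiv ℝ ρ b ≠ 0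
  hessian_pos : ∀ w : Euc n, w ≠ 0 → fderiv ℝ ρ b w = 0 → 0 < fderiv ℝ (fderiv ℝ ρ) b w w

theorem IsStronglyConvexDomain.exists_definingFunction (hD : IsStronglyConvexDomain D)
    (hb : b ∈ frontier D) : ∃ U ρ, IsDefiningFunction D U ρ b := by
  obtain ⟨U, ρ, h1, h2, h3, h4, h5, h6⟩ := hD.boundary b hb
  exact ⟨U, ρ, h1, h2, hb, h3, h4, h5, h6⟩

theorem exists_pos_of_clm_ne_zero {E : Type*} [NormedAddCommGroup E] [NormedSpace ℝ E]
    {l : E →L[ℝ] ℝ} (h : l ≠ 0) : ∃ u, 0 < l u := by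
  obtain ⟨u, hu⟩ := DFunLike.ne_iff.1 h
  rw [zero_apply] at hu
  rcases hu.lt_or_gt with hu | hu
  · exact ⟨-u, by simpa using hu⟩
  · exact ⟨u, hu⟩

theorem tendsto_add_smul_nhds {E : Type*} [NormedAddCommGroup E] [NormedSpace ℝ E] (p u : E) :
    Filter.Tendsto (fun t : ℝ => p + t • u) (nhdsWithin 0 (Set.Ioi 0)) (nhds p) := by
  have : Continuous fun t : ℝ => p + t • u := by fun_prop
  simpa using (this.tendsto 0).mono_left nhdsWithin_le_nhds

theorem hasDerivAt_add_smul {E : Type*} [NormedAddCommGroup E] [NormedSpace ℝ E] (p u : E)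
    (t : ℝ) : HasDerivAt (fun s : ℝ => p + s • u) u t := by
  simpa using ((hasDerivAt_id t).smul_const u).const_add p

theorem tendsto_slope_line {E : Type*} [NormedAddCommGroup E] [NormedSpace ℝ E] {f : E → ℝ}
    {p : E} (hf : DifferentiableAt ℝ f p) (u : E) :
    Filter.Tendsto (fun t : ℝ => t⁻¹ * (f (p + t • u) - f p)) (nhdsWithin 0 (Set.Ioi 0))
      (nhds (fderiv ℝ f p u)) := by
  have h : HasFDerivAt f (fderiv ℝ f p) (p + (0 : ℝ) • u) := by simpa using hf.hasFDerivAt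
  have := (h.comp_hasDerivAt (0 : ℝ) (hasDerivAt_add_smul p u 0)).tendsto_slope_zero_right
  simpa using this

namespace IsDefiningFunction

variable (h : IsDefiningFunction D U ρ b)
include h

theorem contDiffAt {q : Euc n} (hq : q ∈ U) : ContDiffAt ℝ ∞ ρ q :=
  h.smooth.contDiffAt (h.isOpen.mem_nhds hq)

theorem differentiableAt {q : Euc n} (hq : q ∈ U) : DifferentiableAt ℝ ρ q :=
  (h.contDiffAt hq).differentiableAt (by simp)

theorem neg_iff {q : Euc n} (hq : q ∈ U) : q ∈ D ↔ ρ q < 0 := by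
  have : q ∈ D ∩ U ↔ q ∈ {y | ρ y < 0} ∩ U := by rw [h.inter_eq]
  simpa [hq] using this

theorem nonpos_of_mem_closure {q : Euc n} (hq : q ∈ U) (hc : q ∈ closure D) : ρ q ≤ 0 := by
  by_contra! hpos
  have : ∀ᶠ y in nhds q, 0 < ρ y ∧ y ∈ U :=
    ((h.contDiffAt hq).continuousAt.eventually (lt_mem_nhds hpos)).and (h.isOpen.mem_nhds hq)
  obtain ⟨y, h3, h1, h2⟩ := ((mem_closure_iff_frequently.1 hc).and_eventually this).exists
  exact absurd ((h.neg_iff h2).1 h3) (not_lt.2 h1.le)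

theorem eq_zero_of_mem_frontier (hD : IsOpen D) {q : Euc n} (hq : q ∈ U) (hc : q ∈ frontier D) :
    ρ q = 0 := by
  refine le_antisymm (h.nonpos_of_mem_closure hq (frontier_subset_closure hc)) ?_
  rw [← not_lt, ← h.neg_iff hq]
  rw [hD.frontier_eq] at hc
  exact hc.2

/-- Leaving `q` in a direction where `ρ` decreases to first order enters `D`, so `q` is a limit of
points of `D`. -/
theorem mem_frontier_of_eq_zero (hD : IsOpen D) {q : Euc n} (hq : q ∈ U) (h0 : ρ q = 0)
    (hd : fderiv ℝ ρ q ≠ 0) : q ∈ frontier D := by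
  rw [hD.frontier_eq]
  refine ⟨?_, by rw [h.neg_iff hq, h0]; exact lt_irrefl 0⟩
  obtain ⟨u, hu⟩ := exists_pos_of_clm_ne_zero hd
  have ht := tendsto_slope_line (h.differentiableAt hq) (-u)
  have hneg : fderiv ℝ ρ q (-u) < 0 := by simpa using hu
  refine mem_closure_of_tendsto (tendsto_add_smul_nhds q (-u)) ?_
  filter_upwards [ht.eventually (gt_mem_nhds hneg), self_mem_nhdsWithin,
    (tendsto_add_smul_nhds q (-u)).eventually (h.isOpen.mem_nhds hq)] with t h1 h2 h3
  rw [h.neg_iff h3]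
  rw [h0, sub_zero] at h1
  exact (pos_iff_neg_of_mul_neg h1).1 (inv_pos.2 h2)

/-- The segment from `b` to `y` enters `D` at once, so `ρ` has negative difference quotients along
it. -/
theorem fderiv_sub_nonpos (hD : IsOpen D) (hc : Convex ℝ D) {y : Euc n} (hy : y ∈ D) :
    fderiv ℝ ρ b (y - b) ≤ 0 := by
  refine le_of_tendsto (tendsto_slope_line (h.differentiableAt h.mem) (y - b)) ?_
  filter_upwards [self_mem_nhdsWithin, Ioc_mem_nhdsGT zero_lt_one,
    (tendsto_add_smul_nhds b (y - b)).eventually (h.isOpen.mem_nhds h.mem)] with t h1 h2 h3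
  have hm := hc.add_smul_sub_mem_interior' (frontier_subset_closure h.mem_frontier)
    (hD.interior_eq.symm ▸ hy) h2
  have := (h.neg_iff h3).1 (interior_subset hm)
  rw [h.eq_zero_of_mem_frontier hD h.mem h.mem_frontier, sub_zero]
  exact (mul_neg_of_pos_of_neg (inv_pos.2 h1) this).le

/-- Strictness comes from openness: `y` can be pushed slightly in a direction where the nonzero
functional increases. -/
theorem fderiv_lt (hD : IsOpen D) (hc : Convex ℝ D) {y : Euc n} (hy : y ∈ D) :
    fderiv ℝ ρ b y < fderiv ℝ ρ b b := by
  obtain ⟨u, hu⟩ := exists_pos_of_clm_ne_zero h.fderiv_ne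
  have hev := (tendsto_add_smul_nhds y u).eventually (hD.mem_nhds hy)
  obtain ⟨t, ht, ht0⟩ := (hev.and self_mem_nhdsWithin).exists
  have := h.fderiv_sub_nonpos hD hc ht
  simp only [map_sub, map_add, map_smul, smul_eq_mul] at this
  nlinarith [mul_pos (Set.mem_Ioi.1 ht0) hu]

theorem fderiv_le (hD : IsOpen D) (hc : Convex ℝ D) {y : Euc n} (hy : y ∈ closure D) :
    fderiv ℝ ρ b y ≤ fderiv ℝ ρ b b := by
  have : closure D ⊆ {y | fderiv ℝ ρ b y ≤ fderiv ℝ ρ b b} :=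
    closure_minimal (fun y hy => (h.fderiv_lt hD hc hy).le)
      (isClosed_le (fderiv ℝ ρ b).continuous continuous_const)
  exact this hy

/-- Otherwise `w = q - b` is tangent, and the positive Hessian makes `ρ` positive on the segment
from `b` towards `q`, which lies in the closure of `D`, where `ρ ≤ 0`. -/
theorem eq_of_fderiv_eq (hD : IsOpen D) (hc : Convex ℝ D) {q : Euc n} (hq : q ∈ closure D)
    (he : fderiv ℝ ρ b q = fderiv ℝ ρ b b) : q = b := by
  by_contra hne
  set w := q - b with hw
  have hw0 : w ≠ 0 := sub_ne_zero.2 hne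
  have hℓ : fderiv ℝ ρ b w = 0 := by rw [hw, map_sub, he, sub_self]
  obtain ⟨c, hcdef⟩ : ∃ c, c = fderiv ℝ (fderiv ℝ ρ) b w w := ⟨_, rfl⟩
  have hpos : 0 < c := hcdef ▸ h.hessian_pos w hw0 hℓ
  have hcont : Continuous fun t : ℝ => b + t • w := by fun_prop
  have hU : ∀ᶠ t : ℝ in nhds 0, b + t • w ∈ U :=
    hcont.continuousAt.eventually (h.isOpen.mem_nhds (by simpa using h.mem))
  -- Along the line `ρ` has second derivative `c` at `0`. Subtracting `c/4 * s²` leaves `c/2 > 0`,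
  -- so a mere local minimum already gives the strict bound `ρ ≥ c/4 * s² > 0`.
  have hd : ∀ᶠ t : ℝ in nhds 0, HasDerivAt (fun s : ℝ => ρ (b + s • w) - c / 4 * s ^ 2)
      (fderiv ℝ ρ (b + t • w) w - c / 2 * t) t := by
    filter_upwards [hU] with t ht
    have h1 := (h.differentiableAt ht).hasFDerivAt.comp_hasDerivAt t (hasDerivAt_add_smul b w t)
    refine (h1.sub (((hasDerivAt_id' t).pow 2).const_mul (c / 4))).congr_deriv ?_
    norm_num
    ring
  have hd2 : HasDerivAt (fun t : ℝ => fderiv ℝ ρ (b + t • w) w - c / 2 * t) (c / 2) 0 := by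
    have h1 : HasFDerivAt (fderiv ℝ ρ) (fderiv ℝ (fderiv ℝ ρ) b) (b + (0 : ℝ) • w) := by
      rw [zero_smul, add_zero]
      exact ((ContDiffAt.fderiv_right (m := 1) (h.contDiffAt h.mem)
        (by norm_cast)).differentiableAt (by simp)).hasFDerivAt
    have h2 : HasDerivAt (fun t : ℝ => fderiv ℝ ρ (b + t • w))
        (fderiv ℝ (fderiv ℝ ρ) b w) 0 :=
      h1.comp_hasDerivAt (0 : ℝ) (hasDerivAt_add_smul b w 0)
    have h3 := (h2.clm_apply (hasDerivAt_const (0 : ℝ) w)).sub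
      ((hasDerivAt_id' (0 : ℝ)).const_mul (c / 2))
    refine h3.congr_deriv ?_
    rw [map_zero, add_zero, ← hcdef]
    ring
  have hmin : IsLocalMin (fun s : ℝ => ρ (b + s • w) - c / 4 * s ^ 2) 0 := by
    refine isLocalMin_of_deriv_deriv_pos ?_ ?_ hd.self_of_nhds.continuousAt
    · have : deriv (fun s : ℝ => ρ (b + s • w) - c / 4 * s ^ 2) =ᶠ[nhds 0]
          fun t => fderiv ℝ ρ (b + t • w) w - c / 2 * t := hd.mono fun t ht => ht.deriv
      rw [this.deriv_eq, hd2.deriv]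
      positivity
    · rw [hd.self_of_nhds.deriv]
      simp [hℓ]
  have hseg : ∀ t : ℝ, t ∈ Set.Icc (0 : ℝ) 1 → b + t • w ∈ closure D := fun t ht =>
    hc.closure.add_smul_sub_mem (frontier_subset_closure h.mem_frontier) hq ht
  have hev : ∀ᶠ t : ℝ in nhdsWithin 0 (Set.Ioi 0), False := by
    filter_upwards [nhdsWithin_le_nhds hmin, nhdsWithin_le_nhds hU, self_mem_nhdsWithin,
      Ioc_mem_nhdsGT zero_lt_one] with t h1 h2 h3 h4
    have h5 := h.nonpos_of_mem_closure h2 (hseg t ⟨h4.1.le, h4.2⟩)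
    have h6 := h.eq_zero_of_mem_frontier hD h.mem h.mem_frontier
    simp only [zero_smul, add_zero, h6] at h1
    have : 0 < c / 4 * t ^ 2 := by have := h4.1; positivity
    linarith
  exact hev.exists.elim fun _ h => h

end IsDefiningFunction

end Boundary

/-! ### Smoothness, Okada's identity and strong convexity of the Funk metric. -/

section FunkFinsler

variable {n : ℕ} {D U : Set (Euc n)} {ρ : Euc n → ℝ} {x v w : Euc n}

/-- The ray leaves `D` transversally, since the functional is strictly smaller at the interior point
`x` than at the exit point. -/
theorem IsDefiningFunction.fderiv_direction_pos (hD : IsStronglyConvexDomain D) (hx : x ∈ D)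
    (hv : v ≠ 0) (h : IsDefiningFunction D U ρ (x + (funkMetric D x v)⁻¹ • v)) :
    0 < fderiv ℝ ρ (x + (funkMetric D x v)⁻¹ • v) v := by
  have h1 := h.fderiv_lt hD.isOpen hD.convex hx
  rw [map_add, map_smul, smul_eq_mul, lt_add_iff_pos_right] at h1
  exact (pos_iff_pos_of_mul_pos h1).1 (inv_pos.2 (hD.funkMetric_pos hx hv))

/-- Implicit function theorem for `ρ(x + s v) = 0` in `s`; transversality makes the `s`-derivative
nonzero. -/
theorem IsStronglyConvexDomain.funkMetric_smooth (hD : IsStronglyConvexDomain D) :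
    BundleSmooth (slitBundle D) (funkMetric D) := by
  rintro ⟨x, v⟩ ⟨hx, hv⟩
  refine ContDiffAt.contDiffWithinAt ?_
  have hF := hD.funkMetric_pos hx hv
  set t := (funkMetric D x v)⁻¹ with ht
  have ht0 : 0 < t := inv_pos.2 hF
  obtain ⟨U, ρ, h⟩ := hD.exists_definingFunction (hD.exit_mem_frontier hx hv)
  have hℓ := h.fderiv_direction_pos hD hx hv
  rw [← ht] at h hℓ
  let G : (Euc n × Euc n) × ℝ → ℝ := fun p => ρ (p.1.1 + p.2 • p.1.2)
  let u : (Euc n × Euc n) × ℝ := ((x, v), t)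
  have hin : ContDiff ℝ ∞ fun p : (Euc n × Euc n) × ℝ => p.1.1 + p.2 • p.1.2 := by fun_prop
  have hG : ContDiffAt ℝ ∞ G u :=
    ContDiffAt.comp (f := fun p : (Euc n × Euc n) × ℝ => p.1.1 + p.2 • p.1.2) u
      (h.contDiffAt h.mem) hin.contDiffAt
  have hinv : (fderiv ℝ G u ∘L .inr ℝ (Euc n × Euc n) ℝ).IsInvertible := by
    refine ⟨ContinuousLinearEquiv.unitsEquivAut ℝ (Units.mk0 _ hℓ.ne'), ?_⟩
    ext
    have h1 : HasDerivAt (fun s : ℝ => G ((x, v), s)) (fderiv ℝ G u (0, 1)) t :=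
      (hG.differentiableAt (by simp)).hasFDerivAt.comp_hasDerivAt t
        ((hasDerivAt_const t (x, v)).prodMk (hasDerivAt_id t))
    have h2 : HasDerivAt (fun s : ℝ => G ((x, v), s)) (fderiv ℝ ρ (x + t • v) v) t :=
      (h.differentiableAt h.mem).hasFDerivAt.comp_hasDerivAt t (hasDerivAt_add_smul x v t)
    simp [h1.unique h2]
  set ψ := hG.implicitFunction (by simp) hinv
  have hψ : ContDiffAt ℝ ∞ ψ (x, v) := hG.contDiffAt_implicitFunction (by simp) hinv
  have hψ0 : ψ (x, v) = t := hG.implicitFunction_apply_self (by simp) hinv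
  have hψt : 0 < ψ (x, v) := hψ0 ▸ ht0
  have hq : ContinuousAt (fun p : Euc n × Euc n => p.1 + ψ p • p.2) (x, v) := by
    have := hψ.continuousAt
    fun_prop
  have hd : ∀ᶠ q in nhds (x + t • v), fderiv ℝ ρ q ≠ 0 :=
    ((ContDiffAt.fderiv_right (m := 1) (h.contDiffAt h.mem)
      (by norm_cast)).continuousAt).eventually_ne h.fderiv_ne
  have hq0 : (x, v).1 + ψ (x, v) • (x, v).2 = x + t • v := by rw [hψ0]
  -- A zero of `ρ` with nonzero differential is a boundary point, and a ray meets the boundary only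
  -- once, so the local solution `ψ` is the exit time.
  have hev : (fun p : Euc n × Euc n => funkMetric D p.1 p.2) =ᶠ[nhds (x, v)]
      fun p => (ψ p)⁻¹ := by
    filter_upwards [hG.eventually_apply_implicitFunction (by simp) hinv,
      hψ.continuousAt.eventually (lt_mem_nhds hψt),
      (hD.isOpen.preimage continuous_fst).mem_nhds hx,
      hq.eventually (hq0.symm ▸ h.isOpen.mem_nhds h.mem), hq.eventually (hq0.symm ▸ hd)]
      with p h1 h2 h3 h4 h5
    refine hD.funkMetric_eq_inv h3 h2 (h.mem_frontier_of_eq_zero hD.isOpen h4 ?_ h5)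
    rw [show ρ (p.1 + ψ p • p.2) = G u from h1]
    exact h.eq_zero_of_mem_frontier hD.isOpen h.mem h.mem_frontier
  exact (hψ.inv hψt.ne').congr_of_eventuallyEq hev

theorem hasDerivAt_bundle_line {f : Euc n → Euc n → ℝ} (a c : Euc n) {t : ℝ}
    (hf : DifferentiableAt ℝ (fun p : Euc n × Euc n => f p.1 p.2) (x + t • a, v + t • c)) :
    HasDerivAt (fun s : ℝ => f (x + s • a) (v + s • c))
      (bundleDeriv (a, c) f (x + t • a) (v + t • c)) t :=
  HasFDerivAt.comp_hasDerivAt (f := fun s : ℝ => (x + s • a, v + s • c)) t hf.hasFDerivAt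
    ((hasDerivAt_add_smul x a t).prodMk (hasDerivAt_add_smul v c t))

theorem IsStronglyConvexDomain.eventually_mem_slitBundle (hD : IsStronglyConvexDomain D)
    (hx : x ∈ D) (hv : v ≠ 0) (a c : Euc n) :
    ∀ᶠ t : ℝ in nhds 0, (x + t • a, v + t • c) ∈ slitBundle D := by
  have hc : Continuous fun t : ℝ => (x + t • a, v + t • c) := by fun_prop
  exact hc.continuousAt.eventually
    ((isOpen_slitBundle hD.isOpen).mem_nhds (by simpa using ⟨hx, hv⟩))

/-- All exit points lie in the supporting half-space at the exit point of `(x, v)`, so `ℓ` of the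
exit point has a local maximum there, and its derivative vanishes. -/
theorem IsStronglyConvexDomain.support_stationary (hD : IsStronglyConvexDomain D)
    (hx : x ∈ D) (hv : v ≠ 0) (h : IsDefiningFunction D U ρ (x + (funkMetric D x v)⁻¹ • v))
    (a c : Euc n) :
    let ℓ := fderiv ℝ ρ (x + (funkMetric D x v)⁻¹ • v)
    ℓ a + ((funkMetric D x v)⁻¹ * ℓ c
      - bundleDeriv (a, c) (funkMetric D) x v / funkMetric D x v ^ 2 * ℓ v) = 0 := by
  intro ℓ
  have hF := hD.funkMetric_pos hx hv
  have h0 : (x + (0 : ℝ) • a, v + (0 : ℝ) • c) = (x, v) := by simp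
  have hmax : IsLocalMax (fun s : ℝ => ℓ (x + s • a)
      + (funkMetric D (x + s • a) (v + s • c))⁻¹ * ℓ (v + s • c)) 0 := by
    filter_upwards [hD.eventually_mem_slitBundle hx hv a c] with s hs
    have := h.fderiv_le hD.isOpen hD.convex
      (frontier_subset_closure (hD.exit_mem_frontier hs.1 hs.2))
    simp only [zero_smul, add_zero]
    rw [← smul_eq_mul, ← map_smul, ← map_add, ← smul_eq_mul, ← map_smul, ← map_add]
    exact this
  have hd := hasDerivAt_bundle_line (x := x) (v := v) (t := 0) a c
    (by rw [h0]; exact hD.funkMetric_smooth.differentiableAt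
          (isOpen_slitBundle hD.isOpen) ⟨hx, hv⟩)
  simp only [zero_smul, add_zero] at hd
  have hl : ∀ p u : Euc n, HasDerivAt (fun s : ℝ => ℓ (p + s • u)) (ℓ u) 0 := fun p u =>
    ℓ.hasFDerivAt.comp_hasDerivAt (0 : ℝ) (hasDerivAt_add_smul p u 0)
  have hK := (hl x a).add ((hd.inv (by simpa using hF.ne')).mul (hl v c))
  have := hmax.hasDerivAt_eq_zero hK
  simp only [zero_smul, add_zero, Pi.inv_apply] at this
  rw [← this]
  ring

/-- Varying `x` or `v` along the same basis vector expresses `ℓ(e_k)` in two ways; comparison and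
`ℓ(v) ≠ 0` give the identity. -/
theorem IsStronglyConvexDomain.okada (hD : IsStronglyConvexDomain D) (hx : x ∈ D) (hv : v ≠ 0)
    (k : Fin n) :
    partialX (funkMetric D) k x v = funkMetric D x v * partialV (funkMetric D) k x v := by
  obtain ⟨U, ρ, h⟩ := hD.exists_definingFunction (hD.exit_mem_frontier hx hv)
  have hℓ := h.fderiv_direction_pos hD hx hv
  have hF := hD.funkMetric_pos hx hv
  have hd := hD.funkMetric_smooth.differentiableAt (isOpen_slitBundle hD.isOpen) ⟨hx, hv⟩
  have e1 := hD.support_stationary hx hv h (EuclideanSpace.single k 1) 0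
  have e2 := hD.support_stationary hx hv h 0 (EuclideanSpace.single k 1)
  simp only [map_zero, mul_zero, zero_add, zero_sub, ← partialX_eq hd, ← partialV_eq hd] at e1 e2
  set F := funkMetric D x v
  set l := fderiv ℝ ρ (x + F⁻¹ • v) v
  set lk := fderiv ℝ ρ (x + F⁻¹ • v) (EuclideanSpace.single k 1)
  field_simp at e1 e2
  have : (partialX (funkMetric D) k x v - F * partialV (funkMetric D) k x v) * l = 0 := by
    linear_combination F * e2 - e1
  rcases mul_eq_zero.1 this with h | h
  · linarith
  · exact absurd h hℓ.ne'

/-- The expression is half the second derivative of `F²` along `w`. Differentiating `ρ = 0` twice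
along the boundary curve `q(s)` of exit points in directions `v + s w` gives `Q ℓ(v) = F² H`, with
`H` the Hessian of `ρ` on the tangent vector `q'(0)`. If `q'(0) ≠ 0`, then `Q > 0`. If `q'(0) = 0`,
then `w` is a multiple of `v`, so `Q = 0` but `P ≠ 0`. -/
theorem IsStronglyConvexDomain.hessian_funkMetric_pos (hD : IsStronglyConvexDomain D)
    (hx : x ∈ D) (hv : v ≠ 0) (hw : w ≠ 0) :
    0 < bundleDeriv (0, w) (funkMetric D) x v ^ 2
      + funkMetric D x v * bundleDeriv (0, w) (bundleDeriv (0, w) (funkMetric D)) x v := by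
  have hΩ := isOpen_slitBundle hD.isOpen
  have hsm := hD.funkMetric_smooth
  have hF := hD.funkMetric_pos hx hv
  obtain ⟨U, ρ, h⟩ := hD.exists_definingFunction (hD.exit_mem_frontier hx hv)
  have hℓ := h.fderiv_direction_pos hD hx hv
  set b := x + (funkMetric D x v)⁻¹ • v with hb
  set F := funkMetric D x v
  set P := bundleDeriv (0, w) (funkMetric D) x v
  set Q := bundleDeriv (0, w) (bundleDeriv (0, w) (funkMetric D)) x v
  let φ : ℝ → ℝ := fun s => funkMetric D x (v + s • w)
  let φ' : ℝ → ℝ := fun s => bundleDeriv (0, w) (funkMetric D) x (v + s • w)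
  have hmem : ∀ᶠ s : ℝ in nhds 0, (x, v + s • w) ∈ slitBundle D := by
    simpa using hD.eventually_mem_slitBundle hx hv 0 w
  have hφ : ∀ s : ℝ, (x, v + s • w) ∈ slitBundle D → HasDerivAt φ (φ' s) s := by
    intro s hs
    have := hasDerivAt_bundle_line (x := x) (v := v) (t := s) 0 w
      (by simpa using hsm.differentiableAt hΩ hs)
    simpa using this
  have hφ' : HasDerivAt φ' Q 0 := by
    have := hasDerivAt_bundle_line (x := x) (v := v) (t := 0) 0 w
      (by simpa using (hsm.bundleDeriv hΩ (0, w)).differentiableAt hΩ ⟨hx, hv⟩)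
    simpa using this
  have hφ0 : φ 0 = F := by simp [φ, F]
  have hφ'0 : φ' 0 = P := by simp [φ', P]
  let q : ℝ → Euc n := fun s => x + (φ s)⁻¹ • (v + s • w)
  let q' : ℝ → Euc n := fun s => (φ s)⁻¹ • w + (-φ' s / φ s ^ 2) • (v + s • w)
  have hq : ∀ s : ℝ, (x, v + s • w) ∈ slitBundle D → HasDerivAt q (q' s) s := by
    intro s hs
    exact (((hφ s hs).inv (hD.funkMetric_pos hs.1 hs.2).ne').smul
      (hasDerivAt_add_smul v w s)).const_add x
  have hq0 : q 0 = b := by simp [q, hφ0, hb]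
  have hmem0 : (x, v + (0 : ℝ) • w) ∈ slitBundle D := by simpa using ⟨hx, hv⟩
  have hq'0 : q' 0 = F⁻¹ • w + (-P / F ^ 2) • v := by simp [q', hφ0, hφ'0]
  have hq'd : HasDerivAt q' ((-P / F ^ 2) • w
      + ((-P / F ^ 2) • w + ((-Q * F ^ 2 + P * (2 * F * P)) / F ^ 4) • v)) 0 := by
    have d1 := ((hφ 0 hmem0).inv (by simpa [hφ0] using hF.ne')).smul_const w
    have d2 := (hφ'.neg.div ((hφ 0 hmem0).pow 2) (by simpa [hφ0] using hF.ne')).smul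
      (hasDerivAt_add_smul v w 0)
    refine (d1.add d2).congr_deriv ?_
    simp only [hφ0, hφ'0, zero_smul, add_zero, Pi.neg_apply, Pi.pow_apply, Pi.div_apply]
    congr 3
    norm_num
    ring
  have hqU : ∀ᶠ s : ℝ in nhds 0, q s ∈ U :=
    (hq 0 hmem0).continuousAt.eventually (hq0.symm ▸ h.isOpen.mem_nhds h.mem)
  have hρq : ∀ᶠ s : ℝ in nhds 0, ρ (q s) = 0 := by
    filter_upwards [hqU, hmem] with s h1 h2
    exact h.eq_zero_of_mem_frontier hD.isOpen h1 (hD.exit_mem_frontier h2.1 h2.2)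
  have hd1 : ∀ᶠ s : ℝ in nhds 0, fderiv ℝ ρ (q s) (q' s) = 0 := by
    filter_upwards [hqU, hmem, hρq.eventually_nhds] with s h1 h2 h3
    have d := (h.differentiableAt h1).hasFDerivAt.comp_hasDerivAt s (hq s h2)
    exact d.unique ((hasDerivAt_const s (0 : ℝ)).congr_of_eventuallyEq h3)
  have hd2 : HasDerivAt (fun s => fderiv ℝ ρ (q s)) (fderiv ℝ (fderiv ℝ ρ) b (q' 0)) 0 := by
    have h1 : HasFDerivAt (fderiv ℝ ρ) (fderiv ℝ (fderiv ℝ ρ) b) (q 0) := by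
      rw [hq0]
      exact ((ContDiffAt.fderiv_right (m := 1) (h.contDiffAt h.mem)
        (by norm_cast)).differentiableAt (by simp)).hasFDerivAt
    exact h1.comp_hasDerivAt (0 : ℝ) (hq 0 hmem0)
  have e2 := (hd2.clm_apply hq'd).unique ((hasDerivAt_const (0 : ℝ) (0 : ℝ)).congr_of_eventuallyEq hd1)
  have e1 := hd1.self_of_nhds
  rw [hq0] at e1 e2
  have hpos : q' 0 ≠ 0 → 0 < fderiv ℝ (fderiv ℝ ρ) b (q' 0) (q' 0) :=
    fun hne => h.hessian_pos _ hne e1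
  have hzero : q' 0 = 0 → fderiv ℝ (fderiv ℝ ρ) b (q' 0) (q' 0) = 0 := fun h0 => by simp [h0]
  set H := fderiv ℝ (fderiv ℝ ρ) b (q' 0) (q' 0)
  rw [hq'0] at e1
  simp only [map_add, map_smul, smul_eq_mul] at e1 e2
  set l := fderiv ℝ ρ b v
  set m := fderiv ℝ ρ b w
  have hm : m = P / F * l := by
    field_simp at e1 ⊢
    linarith
  have hQ' : Q * l = F ^ 2 * H := by
    rw [hm] at e2
    field_simp at e2
    have : F * (Q * l - F ^ 2 * H) = 0 := by linear_combination -e2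
    rcases mul_eq_zero.1 this with h | h
    · exact absurd h (by positivity)
    · linarith
  by_cases hne : q' 0 = 0
  · have hQ0 : Q = 0 := by
      have : Q * l = 0 := by rw [hQ', hzero hne, mul_zero]
      exact (mul_eq_zero.1 this).resolve_right hℓ.ne'
    rw [hQ0, mul_zero, add_zero]
    have hP0 : P ≠ 0 := by
      intro hP0
      rw [hq'0, hP0] at hne
      simp [hF.ne', hw] at hne
    positivity
  · have : 0 < Q * l := by
      rw [hQ']
      have := hpos hne
      positivity
    have : 0 < Q := (pos_iff_pos_of_mul_pos this).2 hℓ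
    positivity

theorem IsStronglyConvexDomain.fundTensor_posDef (hD : IsStronglyConvexDomain D)
    (hx : x ∈ D) (hv : v ≠ 0) : (fundTensor (funkMetric D) x v).PosDef := by
  have hΩ := isOpen_slitBundle hD.isOpen
  have hsm := hD.funkMetric_smooth
  have hxv : (x, v) ∈ slitBundle D := ⟨hx, hv⟩
  have hg := fundTensor_eq_of_smooth hD.isOpen hsm hxv
  refine Matrix.PosDef.of_dotProduct_mulVec_pos ?_ fun w hw => ?_
  · ext i j
    simp only [Matrix.conjTranspose_apply, star_trivial, hg, partialV_comm hΩ hsm hxv i j]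
    ring
  · have hw' : WithLp.toLp 2 w ≠ (0 : Euc n) := fun h => hw (by simpa using h)
    have key := hD.hessian_funkMetric_pos hx hv hw'
    have s1 := sum_mul_partialV (hsm.differentiableAt hΩ hxv) (WithLp.toLp 2 w)
    have s2 := sum_mul_partialV ((hsm.bundleDeriv hΩ (0, WithLp.toLp 2 w)).differentiableAt hΩ hxv)
      (WithLp.toLp 2 w)
    have s3 : ∀ j, partialV (bundleDeriv (0, WithLp.toLp 2 w) (funkMetric D)) j x v
        = ∑ i, w i * partialV (partialV (funkMetric D) i) j x v := by
      intro j
      rw [partialV_congr (g := fun y z => ∑ i, w i * partialV (funkMetric D) i y z) hΩ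
          (fun y z hyz => (sum_mul_partialV (hsm.differentiableAt hΩ hyz) _).symm)
          (BundleSmooth.sum fun i _ => (BundleSmooth.const _).mul (hsm.partialV hΩ i)) hxv,
        partialV_sum hΩ (fun i _ => (BundleSmooth.const _).mul (hsm.partialV hΩ i)) hxv]
      refine Finset.sum_congr rfl fun i _ => ?_
      rw [partialV_mul hΩ (BundleSmooth.const _) (hsm.partialV hΩ i) hxv,
        partialV_eq (f := fun _ _ => w i) (by fun_prop), bundleDeriv_const]
      ring
    rw [← s1, ← s2] at key
    simp only [s3] at key
    refine lt_of_lt_of_eq key ?_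
    simp only [dotProduct, Matrix.mulVec, star_trivial, hg, sq, Finset.sum_mul,
      Finset.mul_sum, ← Finset.sum_add_distrib]
    exact Finset.sum_congr rfl fun i _ => Finset.sum_congr rfl fun j _ => by
      rw [partialV_comm hΩ hsm hxv i j]
      ring

theorem IsStronglyConvexDomain.isOkadaMetric (hD : IsStronglyConvexDomain D) :
    IsOkadaMetric D (funkMetric D) where
  isOpen := hD.isOpen
  finsler :=
    { nonneg := fun x hx v => by
        rw [hD.funkMetric_eq_gauge hx]
        exact gauge_nonneg v
      smooth := hD.funkMetric_smooth
      homogeneous := fun x hx v c hc => hD.funkMetric_smul hx v hc.le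
      strongConvex := fun x hx v hv => hD.fundTensor_posDef hx hv }
  okada := fun _ hx _ hv k => hD.okada hx hv k

end FunkFinsler

/-! ### Calibrations and the Funk distance. -/

section FunkDistance

variable {n : ℕ} {D U : Set (Euc n)} {ρ : Euc n → ℝ} {b x y v : Euc n} {ξ : ℝ → Euc n} {α β : ℝ}

theorem IsStronglyConvexDomain.funkMetric_nonneg (hD : IsStronglyConvexDomain D) (hx : x ∈ D)
    (v : Euc n) : 0 ≤ funkMetric D x v := by
  rw [hD.funkMetric_eq_gauge hx]
  exact gauge_nonneg v

theorem IsStronglyConvexDomain.mul_funkMetric_le (hD : IsStronglyConvexDomain D) (hx : x ∈ D)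
    {r : ℝ} (hr : Metric.ball x r ⊆ D) (v : Euc n) : r * funkMetric D x v ≤ ‖v‖ := by
  rw [hD.funkMetric_eq_gauge hx]
  refine mul_gauge_le_norm fun z hz => hr ?_
  simpa [dist_eq_norm] using hz

theorem IsStronglyConvexDomain.funkMetric_lt_one (hD : IsStronglyConvexDomain D) (hx : x ∈ D)
    (hy : y ∈ D) : funkMetric D x (y - x) < 1 := by
  rw [hD.funkMetric_eq_gauge hx,
    gauge_lt_one_iff_mem_interior (hD.convex_preimage x) (hD.preimage_mem_nhds hx),
    (hD.isOpen.preimage (continuous_const_add x)).interior_eq]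
  simpa using hy

/-- Continuity must include the zero section, because competing curves in the distance may have
vanishing velocity. There it follows from a bound of `F` by the norm, uniform near `x`. -/
theorem IsStronglyConvexDomain.continuousOn_funkMetric (hD : IsStronglyConvexDomain D) :
    ContinuousOn (fun p : Euc n × Euc n => funkMetric D p.1 p.2) (D ×ˢ Set.univ) := by
  rintro ⟨x, v⟩ ⟨hx, -⟩
  refine ContinuousAt.continuousWithinAt ?_
  rcases eq_or_ne v 0 with rfl | hv
  · obtain ⟨r, hr, hball⟩ := Metric.isOpen_iff.1 hD.isOpen x hx
    have hr2 : 0 < r / 2 := half_pos hr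
    rw [ContinuousAt, funkMetric_zero]
    have hnear : ∀ᶠ p : Euc n × Euc n in nhds (x, 0), p.1 ∈ Metric.ball x (r / 2) :=
      continuous_fst.continuousAt.eventually (Metric.ball_mem_nhds x hr2)
    have hlim : Filter.Tendsto (fun p : Euc n × Euc n => ‖p.2‖ / (r / 2)) (nhds (x, 0))
        (nhds 0) := by
      have : Continuous fun p : Euc n × Euc n => ‖p.2‖ / (r / 2) := by fun_prop
      simpa using this.tendsto (x, (0 : Euc n))
    refine squeeze_zero' ?_ ?_ hlim
    · filter_upwards [hnear] with p hp
      exact hD.funkMetric_nonneg (hball (Metric.ball_subset_ball (by linarith) hp)) _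
    · filter_upwards [hnear] with p hp
      rw [le_div_iff₀' hr2]
      refine hD.mul_funkMetric_le (hball (Metric.ball_subset_ball (by linarith) hp)) ?_ _
      refine (Metric.ball_subset_ball' ?_).trans hball
      rw [Metric.mem_ball] at hp
      linarith
  · exact (hD.funkMetric_smooth.contDiffAt (isOpen_slitBundle hD.isOpen) ⟨hx, hv⟩).continuousAt

namespace IsDefiningFunction

theorem fderiv_le_funkMetric_mul (hD : IsStronglyConvexDomain D) (h : IsDefiningFunction D U ρ b)
    (hx : x ∈ D) (v : Euc n) :
    fderiv ℝ ρ b v ≤ funkMetric D x v * (fderiv ℝ ρ b b - fderiv ℝ ρ b x) := by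
  rcases eq_or_ne v 0 with rfl | hv
  · simp [funkMetric_zero]
  · have hF := hD.funkMetric_pos hx hv
    have := h.fderiv_le hD.isOpen hD.convex
      (frontier_subset_closure (hD.exit_mem_frontier hx hv))
    rw [map_add, map_smul, smul_eq_mul, ← le_sub_iff_add_le', inv_mul_le_iff₀ hF] at this
    exact this

/-- The calibration inequality: along a curve the left side is the derivative of `-log(ℓ(b) -
ℓ(ξ))`, so its integral depends only on the endpoints. -/
theorem fderiv_div_le (hD : IsStronglyConvexDomain D) (h : IsDefiningFunction D U ρ b)
    (hx : x ∈ D) (v : Euc n) :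
    fderiv ℝ ρ b v / (fderiv ℝ ρ b b - fderiv ℝ ρ b x) ≤ funkMetric D x v := by
  rw [div_le_iff₀ (sub_pos.2 (h.fderiv_lt hD.isOpen hD.convex hx))]
  exact h.fderiv_le_funkMetric_mul hD hx v

theorem continuousOn_fderiv_div (hD : IsStronglyConvexDomain D) (h : IsDefiningFunction D U ρ b) :
    ContinuousOn (fun p : Euc n × Euc n =>
      fderiv ℝ ρ b p.2 / (fderiv ℝ ρ b b - fderiv ℝ ρ b p.1)) (D ×ˢ Set.univ) := by
  refine ContinuousOn.div (by fun_prop) (by fun_prop) fun p hp => ?_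
  exact (sub_pos.2 (h.fderiv_lt hD.isOpen hD.convex hp.1)).ne'

end IsDefiningFunction

theorem derivWithin_Icc_eq_deriv {u : ℝ} (hu : u ∈ Set.Ioo α β) :
    derivWithin ξ (Set.Icc α β) u = deriv ξ u :=
  derivWithin_of_mem_nhds (Icc_mem_nhds hu.1 hu.2)

theorem continuousOn_velocity {G : Euc n × Euc n → ℝ} (hG : ContinuousOn G (D ×ˢ Set.univ))
    (hαβ : α < β) (hξ : ContDiffOn ℝ 1 ξ (Set.Icc α β)) (hm : ∀ u ∈ Set.Icc α β, ξ u ∈ D) :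
    ContinuousOn (fun u => G (ξ u, derivWithin ξ (Set.Icc α β) u)) (Set.Icc α β) :=
  hG.comp (hξ.continuousOn.prodMk
    (hξ.continuousOn_derivWithin (uniqueDiffOn_Icc hαβ) le_rfl)) fun u hu => ⟨hm u hu, trivial⟩

/-- At the endpoints `deriv ξ` need not be the one-sided derivative, so integrability is transferred
from `derivWithin`, which agrees with it on the open interval. -/
theorem intervalIntegrable_velocity {G : Euc n × Euc n → ℝ}
    (hG : ContinuousOn G (D ×ˢ Set.univ)) (hαβ : α < β) (hξ : ContDiffOn ℝ 1 ξ (Set.Icc α β))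
    (hm : ∀ u ∈ Set.Icc α β, ξ u ∈ D) :
    IntervalIntegrable (fun u => G (ξ u, deriv ξ u)) MeasureTheory.volume α β := by
  refine ((continuousOn_velocity hG hαβ hξ hm).intervalIntegrable_of_Icc hαβ.le).congr_uIoo ?_
  rw [Set.uIoo_of_le hαβ.le]
  intro u hu
  simp only [derivWithin_Icc_eq_deriv hu]

namespace IsDefiningFunction

theorem integral_fderiv_div (hD : IsStronglyConvexDomain D) (h : IsDefiningFunction D U ρ b)
    (hαβ : α < β) (hξ : ContDiffOn ℝ 1 ξ (Set.Icc α β)) (hm : ∀ u ∈ Set.Icc α β, ξ u ∈ D) :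
    (∫ u in α..β, fderiv ℝ ρ b (deriv ξ u) / (fderiv ℝ ρ b b - fderiv ℝ ρ b (ξ u))) =
      Real.log (fderiv ℝ ρ b b - fderiv ℝ ρ b (ξ α))
        - Real.log (fderiv ℝ ρ b b - fderiv ℝ ρ b (ξ β)) := by
  have hpos : ∀ u ∈ Set.Icc α β, 0 < fderiv ℝ ρ b b - fderiv ℝ ρ b (ξ u) := fun u hu =>
    sub_pos.2 (h.fderiv_lt hD.isOpen hD.convex (hm u hu))
  have key := intervalIntegral.integral_eq_sub_of_hasDerivAt_of_le
    (f := fun u => -Real.log (fderiv ℝ ρ b b - fderiv ℝ ρ b (ξ u)))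
    (f' := fun u => fderiv ℝ ρ b (deriv ξ u) / (fderiv ℝ ρ b b - fderiv ℝ ρ b (ξ u)))
    hαβ.le ?_ ?_ (intervalIntegrable_velocity (h.continuousOn_fderiv_div hD) hαβ hξ hm)
  · rw [key]
    ring
  · have hc : ContinuousOn (fun u => fderiv ℝ ρ b (ξ u)) (Set.Icc α β) :=
      (fderiv ℝ ρ b).continuous.comp_continuousOn hξ.continuousOn
    exact ((continuousOn_const.sub hc).log fun u hu => (hpos u hu).ne').neg
  · intro u hu
    have hd : HasDerivAt ξ (deriv ξ u) u :=
      ((hξ.differentiableOn (by simp)).differentiableAt (Icc_mem_nhds hu.1 hu.2)).hasDerivAt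
    have h1 := (fderiv ℝ ρ b).hasFDerivAt.comp_hasDerivAt u hd
    have h2 := ((h1.const_sub (fderiv ℝ ρ b b)).log (hpos u (Set.Ioo_subset_Icc_self hu)).ne').neg
    refine h2.congr_deriv ?_
    simp only [Function.comp_apply]
    ring

theorem le_length (hD : IsStronglyConvexDomain D) (h : IsDefiningFunction D U ρ b)
    (hαβ : α < β) (hξ : ContDiffOn ℝ 1 ξ (Set.Icc α β)) (hm : ∀ u ∈ Set.Icc α β, ξ u ∈ D) :
    Real.log (fderiv ℝ ρ b b - fderiv ℝ ρ b (ξ α))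
        - Real.log (fderiv ℝ ρ b b - fderiv ℝ ρ b (ξ β)) ≤
      ∫ u in α..β, funkMetric D (ξ u) (deriv ξ u) := by
  rw [← h.integral_fderiv_div hD hαβ hξ hm]
  exact intervalIntegral.integral_mono_on hαβ.le
    (intervalIntegrable_velocity (h.continuousOn_fderiv_div hD) hαβ hξ hm)
    (intervalIntegrable_velocity hD.continuousOn_funkMetric hαβ hξ hm)
    fun u hu => h.fderiv_div_le hD (hm u hu) _

end IsDefiningFunction

theorem IsStronglyConvexDomain.finslerDist_self (hD : IsStronglyConvexDomain D) (hx : x ∈ D) :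
    finslerDist D (funkMetric D) x x = 0 := by
  refine IsLeast.csInf_eq ⟨⟨fun _ => x, contDiffOn_const, fun _ _ => hx, rfl, rfl, ?_⟩, ?_⟩
  · simp [funkMetric_zero]
  · rintro L ⟨ξ, -, hm, -, -, rfl⟩
    exact intervalIntegral.integral_nonneg zero_le_one fun u hu => hD.funkMetric_nonneg (hm u hu) _

/-- The calibration at `b` bounds every length from below. The straight segment points at `b`
throughout, so it attains equality. -/
theorem IsDefiningFunction.finslerDist_eq (hD : IsStronglyConvexDomain D)
    (h : IsDefiningFunction D U ρ b) (hx : x ∈ D) (hy : y ∈ D) {τ : ℝ} (hτ : 0 < τ)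
    (hb : b = x + τ • (y - x)) :
    finslerDist D (funkMetric D) x y =
      Real.log (fderiv ℝ ρ b b - fderiv ℝ ρ b x) - Real.log (fderiv ℝ ρ b b - fderiv ℝ ρ b y) := by
  refine IsLeast.csInf_eq ⟨?_, ?_⟩
  · have hτ1 : 1 < τ := by
      have h1 := hD.funkMetric_lt_one hx hy
      rw [hD.funkMetric_eq_inv hx hτ (hb ▸ h.mem_frontier)] at h1
      exact (inv_lt_one₀ hτ).1 h1
    have hd : ∀ u : ℝ, deriv (fun s : ℝ => x + s • (y - x)) u = y - x := fun u =>
      (hasDerivAt_add_smul x (y - x) u).deriv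
    have hs : ContDiff ℝ 1 fun s : ℝ => x + s • (y - x) := by fun_prop
    have hm : ∀ u ∈ Set.Icc (0 : ℝ) 1, x + u • (y - x) ∈ D := fun u hu =>
      hD.convex.add_smul_sub_mem hx hy hu
    refine ⟨fun s => x + s • (y - x), hs.contDiffOn, hm, by simp, by simp, ?_⟩
    have e := h.integral_fderiv_div hD zero_lt_one hs.contDiffOn hm
    simp only [zero_smul, add_zero, one_smul, add_sub_cancel] at e
    rw [← e]
    refine intervalIntegral.integral_congr fun u hu => ?_
    rw [Set.uIcc_of_le zero_le_one] at hu
    have hu1 : 0 < τ - u := by linarith [hu.2]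
    have hlt := h.fderiv_lt hD.isOpen hD.convex (hm u hu)
    have hbu : b - (x + u • (y - x)) = (τ - u) • (y - x) := by
      rw [hb, sub_smul]
      abel
    have e2 : fderiv ℝ ρ b b - fderiv ℝ ρ b (x + u • (y - x))
        = (τ - u) * fderiv ℝ ρ b (y - x) := by
      rw [← map_sub, hbu, map_smul, smul_eq_mul]
    have hne : fderiv ℝ ρ b (y - x) ≠ 0 := by
      intro h0
      rw [h0, mul_zero] at e2
      linarith
    have hF : funkMetric D (x + u • (y - x)) (y - x) = (τ - u)⁻¹ := by
      refine hD.funkMetric_eq_inv (hm u hu) hu1 ?_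
      rw [← hbu, add_sub_cancel]
      exact h.mem_frontier
    simp only [hd]
    rw [e2, hF]
    field_simp
  · rintro L ⟨ξ, hξ, hm, rfl, rfl, rfl⟩
    exact h.le_length hD zero_lt_one hξ hm

end FunkDistance

/-! ### Existence and rigidity of unit-speed geodesics. -/

section FunkGeodesic

variable {n : ℕ} {D U : Set (Euc n)} {x v : Euc n} {ε : ℝ} {η : ℝ → Euc n}

/-- The curve solves `η + η' = x + v`: its exit point is always `x + v`, which means unit speed. -/
theorem IsStronglyConvexDomain.exists_geodesic (hD : IsStronglyConvexDomain D) (hx : x ∈ D)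
    (hv : funkMetric D x v = 1) :
    ∃ ε > 0, ∃ η : ℝ → Euc n, IsGeodesic D (funkMetric D) ε η ∧ η 0 = x ∧ deriv η 0 = v := by
  obtain ⟨η, hη⟩ : ∃ η : ℝ → Euc n, η = fun t => x + (1 - Real.exp (-t)) • v := ⟨_, rfl⟩
  have hb : x + v ∈ frontier D := (hD.funkMetric_eq_one_iff hx).1 hv
  obtain ⟨U, ρ, h⟩ := hD.exists_definingFunction hb
  have hd : ∀ t, deriv η t = Real.exp (-t) • v := by
    intro t
    have h1 := ((((hasDerivAt_id' t).neg).exp).const_sub 1).smul_const v |>.const_add x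
    rw [hη]
    refine h1.deriv.trans ?_
    simp
  have hsum : ∀ t, η t + deriv η t = x + v := by
    intro t
    rw [hd, hη]
    module
  have hη0 : η 0 = x := by simp [hη]
  have hsm : ContDiff ℝ ∞ η := by
    rw [hη]
    fun_prop
  have hspeed : ∀ t, η t ∈ D → funkMetric D (η t) (deriv η t) = 1 := fun t ht => by
    rw [hD.funkMetric_eq_one_iff ht, hsum]
    exact hb
  have hnhds : η ⁻¹' D ∈ nhds (0 : ℝ) :=
    hsm.continuous.continuousAt.preimage_mem_nhds (hD.isOpen.mem_nhds (hη0 ▸ hx))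
  obtain ⟨ε, hε, hball⟩ := Metric.mem_nhds_iff.1 hnhds
  have hm : ∀ t ∈ Set.Ioo (-ε) ε, η t ∈ D := fun t ht => hball (by
    rw [Real.ball_eq_Ioo]
    simpa using ht)
  have hℓ : 0 < fderiv ℝ ρ (x + v) v := by
    have := h.fderiv_lt hD.isOpen hD.convex hx
    rw [map_add] at this
    linarith
  refine ⟨ε, hε, η, ⟨hsm.contDiffOn, hm, ⟨1, fun t ht => hspeed t (hm t ht)⟩, fun t₀ _ =>
    ⟨1, one_pos, fun s hs t ht hst => ?_⟩⟩, hη0, by simp [hd]⟩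
  have hint : (∫ u in s..t, funkMetric D (η u) (deriv η u)) = t - s := by
    rw [intervalIntegral.integral_congr (g := fun _ => (1 : ℝ)), intervalIntegral.integral_const,
      smul_eq_mul, mul_one]
    intro u hu
    rw [Set.uIcc_of_le hst] at hu
    exact hspeed u (hm u ⟨hs.1.1.trans_le hu.1, hu.2.trans_lt ht.1.2⟩)
  rw [hint]
  rcases hst.eq_or_lt with rfl | hlt
  · rw [hD.finslerDist_self (hm s hs.1), sub_self]
  · have hc : 0 < 1 - Real.exp (s - t) := by
      rw [sub_pos, Real.exp_lt_one_iff]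
      linarith
    have hexp : Real.exp (-t) = Real.exp (s - t) * Real.exp (-s) := by
      rw [← Real.exp_add]
      congr 1
      ring
    have hdiff : η t - η s = ((1 - Real.exp (s - t)) * Real.exp (-s)) • v := by
      rw [sub_mul, one_mul, ← hexp, hη]
      module
    -- All chords point at the same boundary point, so one functional computes every distance; `ℓ(b)
    -- - ℓ(η u)` decays like `exp(-u)`, which gives distance `t - s`.
    have hbs : x + v = η s + (1 - Real.exp (s - t))⁻¹ • (η t - η s) := by
      rw [hdiff, smul_smul, ← mul_assoc, inv_mul_cancel₀ hc.ne', one_mul, ← hd, hsum]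
    have hh : ∀ u, fderiv ℝ ρ (x + v) (x + v) - fderiv ℝ ρ (x + v) (η u)
        = Real.exp (-u) * fderiv ℝ ρ (x + v) v := by
      intro u
      rw [← map_sub, ← hsum u, add_sub_cancel_left, hd, map_smul, smul_eq_mul]
    rw [h.finslerDist_eq hD (hm s hs.1) (hm t ht.1) (inv_pos.2 hc) hbs, hh, hh,
      Real.log_mul (Real.exp_ne_zero _) hℓ.ne', Real.log_mul (Real.exp_ne_zero _) hℓ.ne',
      Real.log_exp, Real.log_exp]
    ring

/-- Take for `b` the exit point of the chord of a short minimizing arc. Minimality turns the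
calibration inequality into an equality of integrals, hence a pointwise one by continuity. So the
boundary point `η + η'` lies on the supporting hyperplane at `b`, and strict convexity identifies it
with `b`. -/
theorem IsGeodesic.eventually_add_deriv (hD : IsStronglyConvexDomain D)
    (hη : IsGeodesic D (funkMetric D) ε η) (hε : 0 < ε) (h0 : η 0 = x) (h0' : deriv η 0 = v)
    (hv : funkMetric D x v = 1) : ∀ᶠ t in nhds (0 : ℝ), η t + deriv η t = x + v := by
  have hz : (0 : ℝ) ∈ Set.Ioo (-ε) ε := ⟨by linarith, hε⟩
  have hspeed : ∀ t ∈ Set.Ioo (-ε) ε, funkMetric D (η t) (deriv η t) = 1 := by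
    obtain ⟨c, hc⟩ := hη.constSpeed
    have := hc 0 hz
    rw [h0, h0', hv] at this
    exact this ▸ hc
  obtain ⟨δ, hδ, hmin⟩ := hη.locallyMinimizing 0 hz
  set r := min ε δ / 2
  have hr0 : 0 < r := half_pos (lt_min hε hδ)
  have hrε : r < ε := (half_lt_self (lt_min hε hδ)).trans_le (min_le_left _ _)
  have hrδ : r < δ := (half_lt_self (lt_min hε hδ)).trans_le (min_le_right _ _)
  have hrr : -r < r := by linarith
  have hsub : Set.Icc (-r) r ⊆ Set.Ioo (-ε) ε := fun u hu =>
    ⟨by linarith [hu.1], by linarith [hu.2]⟩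
  have hm : ∀ u ∈ Set.Icc (-r) r, η u ∈ D := fun u hu => hη.mapsTo u (hsub hu)
  have hsm : ContDiffOn ℝ 1 η (Set.Icc (-r) r) := (hη.smooth.mono hsub).of_le (by simp)
  have hdist := hmin (-r) ⟨hsub ⟨le_rfl, hrr.le⟩, by constructor <;> linarith⟩ r
    ⟨hsub ⟨hrr.le, le_rfl⟩, by constructor <;> linarith⟩ hrr.le
  have hint : (∫ u in (-r)..r, funkMetric D (η u) (deriv η u)) = 2 * r := by
    rw [intervalIntegral.integral_congr (g := fun _ => (1 : ℝ)), intervalIntegral.integral_const,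
      smul_eq_mul, mul_one]
    · ring
    · intro u hu
      rw [Set.uIcc_of_le hrr.le] at hu
      exact hspeed u (hsub hu)
  have hmr := hm (-r) ⟨le_rfl, hrr.le⟩
  have hmr' := hm r ⟨hrr.le, le_rfl⟩
  -- The chord is nondegenerate because the arc has length `2 * r > 0`, while the distance from a
  -- point to itself is `0`.
  have hne : η r - η (-r) ≠ 0 := by
    intro he
    rw [sub_eq_zero.1 he, hD.finslerDist_self hmr, hint] at hdist
    linarith
  obtain ⟨b, hb⟩ : ∃ b, b = η (-r) + (funkMetric D (η (-r)) (η r - η (-r)))⁻¹ • (η r - η (-r)) :=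
    ⟨_, rfl⟩
  obtain ⟨U, ρ, h⟩ := hD.exists_definingFunction (hb ▸ hD.exit_mem_frontier hmr hne)
  rw [h.finslerDist_eq hD hmr hmr' (inv_pos.2 (hD.funkMetric_pos hmr hne)) hb, hint,
    ← h.integral_fderiv_div hD hrr hsm hm] at hdist
  have hcont : ContinuousOn (fun u => 1 - fderiv ℝ ρ b (deriv η u)
      / (fderiv ℝ ρ b b - fderiv ℝ ρ b (η u))) (Set.Icc (-r) r) := by
    have hd : ContinuousOn (deriv η) (Set.Icc (-r) r) :=
      (hη.smooth.continuousOn_deriv_of_isOpen isOpen_Ioo (by simp)).mono hsub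
    exact continuousOn_const.sub ((h.continuousOn_fderiv_div hD).comp
      (hsm.continuousOn.prodMk hd) fun u hu => ⟨hm u hu, trivial⟩)
  have hle : ∀ u ∈ Set.Icc (-r) r, 0 ≤ 1 - fderiv ℝ ρ b (deriv η u)
      / (fderiv ℝ ρ b b - fderiv ℝ ρ b (η u)) := by
    intro u hu
    rw [sub_nonneg, ← hspeed u (hsub hu)]
    exact h.fderiv_div_le hD (hm u hu) _
  have hzero : (∫ u in (-r)..r, (1 - fderiv ℝ ρ b (deriv η u)
      / (fderiv ℝ ρ b b - fderiv ℝ ρ b (η u)))) = 0 := by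
    rw [intervalIntegral.integral_sub intervalIntegrable_const
      (intervalIntegrable_velocity (h.continuousOn_fderiv_div hD) hrr hsm hm), ← hdist,
      intervalIntegral.integral_const, smul_eq_mul]
    ring
  have key : ∀ u ∈ Set.Icc (-r) r, η u + deriv η u = b := by
    intro u hu
    have he : 1 - fderiv ℝ ρ b (deriv η u) / (fderiv ℝ ρ b b - fderiv ℝ ρ b (η u)) = 0 := by
      by_contra hne
      exact (intervalIntegral.integral_pos hrr hcont (fun u hu => hle u ⟨hu.1.le, hu.2⟩)
        ⟨u, hu, lt_of_le_of_ne (hle u hu) (Ne.symm hne)⟩).ne' hzero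
    have hpos := sub_pos.2 (h.fderiv_lt hD.isOpen hD.convex (hm u hu))
    rw [sub_eq_zero, eq_div_iff hpos.ne', one_mul] at he
    refine h.eq_of_fderiv_eq hD.isOpen hD.convex (frontier_subset_closure
      ((hD.funkMetric_eq_one_iff (hm u hu)).1 (hspeed u (hsub hu)))) ?_
    rw [map_add]
    linarith
  have hb0 := key 0 ⟨by linarith, hr0.le⟩
  rw [h0, h0'] at hb0
  filter_upwards [Icc_mem_nhds (by linarith : -r < 0) hr0] with t ht
  rw [key t ht, hb0]

end FunkGeodesic

/-! ### The weight of Lebesgue measure along geodesics. -/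

section Weight

variable {n : ℕ} {D : Set (Euc n)} {F : Euc n → Euc n → ℝ} {x v : Euc n} {ε : ℝ} {η : ℝ → Euc n}

/-- Jacobi's formula for the derivative of a determinant. -/
theorem hasDerivAt_matrix_det {A : ℝ → Matrix (Fin n) (Fin n) ℝ} {A' : Matrix (Fin n) (Fin n) ℝ}
    {t : ℝ} (hA : ∀ i j, HasDerivAt (fun s => A s i j) (A' i j) t) :
    HasDerivAt (fun s => (A s).det) ((A t).adjugate * A').trace t := by
  simp only [Matrix.det_apply']
  refine (HasDerivAt.fun_sum fun σ _ =>
    (HasDerivAt.fun_finsetProd fun i _ => hA (σ i) i).const_mul _).congr_deriv ?_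
  -- By Cramer's rule, each diagonal entry is the determinant with one column differentiated, as in
  -- the product rule.
  have e : ∀ i, ((A t).adjugate * A') i i = ((A t).updateCol i fun k => A' k i).det := by
    intro i
    rw [← Matrix.cramer_apply, Matrix.cramer_eq_adjugate_mulVec]
    rfl
  simp only [Matrix.trace, Matrix.diag_apply, e, Matrix.det_apply', Finset.mul_sum]
  rw [Finset.sum_comm]
  refine Finset.sum_congr rfl fun i _ => Finset.sum_congr rfl fun σ _ => ?_
  rw [← Finset.prod_erase_mul _ _ (Finset.mem_univ i), Matrix.updateCol_self, smul_eq_mul]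
  congr 2
  exact Finset.prod_congr rfl fun j hj => (Matrix.updateCol_ne (Finset.ne_of_mem_erase hj)).symm

namespace IsOkadaMetric

variable (hF : IsOkadaMetric D F)
include hF

/-- The vertical part `c • v` contributes nothing, as `g` is `0`-homogeneous. Geodesics need `c =
-1`. -/
theorem bundleDeriv_fundTensor (h : (x, v) ∈ slitBundle D) (i j : Fin n) (c : ℝ) :
    bundleDeriv (v, c • v) (fun y w => fundTensor F y w i j) x v =
      F x v * (fundTensor F x v i j + partialV F i x v * partialV F j x v) := by
  have hd := (hF.fundTensor_smooth i j).differentiableAt hF.isOpen_slit h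
  have e1 := sum_mul_partialX (f := fun y w => fundTensor F y w i j) hd v
  have e2 := sum_mul_partialV (f := fun y w => fundTensor F y w i j) hd v
  have e3 : ∑ k, v k * partialV (fun y w => fundTensor F y w i j) k x v = 0 := by
    have := hF.cartan_contract h i j
    calc _ = 2 * ∑ k, cartan F i j k x v * v k := by
          rw [Finset.mul_sum]
          refine Finset.sum_congr rfl fun k _ => ?_
          rw [cartan]
          ring
      _ = 0 := by rw [this, mul_zero]
  have e4 : (v, c • v) = (v, 0) + c • ((0 : Euc n), v) := by simp
  rw [← hF.partialX_fundTensor_contract h]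
  rw [bundleDeriv] at e1 e2 ⊢
  rw [e4, map_add, map_smul, ← e1, ← e2, e3, smul_zero, add_zero]
  exact Finset.sum_congr rfl fun k _ => mul_comm _ _

/-- For `F = 1` the trace of `g⁻¹ (g + d_vF ⊗ d_vF)` is `n + vⁱ ∂F/∂vⁱ = n + 1`. -/
theorem trace_adjugate_mul (h : (x, v) ∈ slitBundle D) (h1 : F x v = 1) :
    ((fundTensor F x v).adjugate * Matrix.of fun i j =>
      F x v * (fundTensor F x v i j + partialV F i x v * partialV F j x v)).trace =
      (n + 1) * (fundTensor F x v).det := by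
  have hu := hF.isUnit_det h
  have hadj : (fundTensor F x v).adjugate = (fundTensor F x v).det • fundTensorInv F x v := by
    rw [fundTensorInv, Matrix.inv_def, smul_smul, Ring.mul_inverse_cancel _ hu, one_smul]
  have e : ∀ i, (fundTensorInv F x v * Matrix.of fun i j =>
      F x v * (fundTensor F x v i j + partialV F i x v * partialV F j x v)) i i =
      1 + v i * partialV F i x v := by
    intro i
    have := hF.half_inv_mul h i i
    rw [if_pos rfl, h1] at this
    rw [Matrix.mul_apply]
    simp only [Matrix.of_apply, h1]
    linarith
  rw [hadj, Matrix.smul_mul, Matrix.trace_smul, Matrix.trace, smul_eq_mul, mul_comm]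
  simp only [Matrix.diag_apply, e, Finset.sum_add_distrib, hF.euler₀ h, Finset.sum_const,
    Finset.card_univ, Fintype.card_fin, nsmul_eq_mul, mul_one]
  rw [h1]

theorem det_pos (h : (x, v) ∈ slitBundle D) : 0 < (fundTensor F x v).det :=
  (hF.finsler.strongConvex x h.1 v h.2).det_pos

end IsOkadaMetric

/-- The density is `1`, so `Ψ = (log det g) / 2`. Its derivative is constant near `0`, which is why
`hK` has second derivative `0` and does not involve the geodesic. -/
theorem IsStronglyConvexDomain.hasWeightedRicci (hD : IsStronglyConvexDomain D) (hx : x ∈ D)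
    (hv : funkMetric D x v = 1) (N K : EReal)
    (hK : weightedRicciValue n N (-((n : ℝ) - 1) / 4) (((n : ℝ) + 1) / 2) 0 = K) :
    HasWeightedRicci D (funkMetric D)
      ((MeasureTheory.volume : MeasureTheory.Measure (Euc n)).restrict D) N x v K := by
  have hF := hD.isOkadaMetric
  refine ⟨fun _ => 1, ⟨contDiffOn_const, fun _ _ => one_pos, ?_⟩, hD.exists_geodesic hx hv, ?_⟩
  · simp only [ENNReal.ofReal_one]
    exact MeasureTheory.withDensity_one.symm
  intro ε hε η hη h0 h0'
  have hz : (0 : ℝ) ∈ Set.Ioo (-ε) ε := ⟨by linarith, hε⟩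
  have hspeed : ∀ t ∈ Set.Ioo (-ε) ε, funkMetric D (η t) (deriv η t) = 1 := by
    obtain ⟨c, hc⟩ := hη.constSpeed
    have := hc 0 hz
    rw [h0, h0', hv] at this
    exact this ▸ hc
  have hmem : ∀ t ∈ Set.Ioo (-ε) ε, (η t, deriv η t) ∈ slitBundle D := by
    refine fun t ht => ⟨hη.mapsTo t ht, fun hzero => ?_⟩
    have := hspeed t ht
    rw [show deriv η t = 0 from hzero, funkMetric_zero] at this
    exact zero_ne_one this
  have hdet : ContDiffOn ℝ ∞ (fun t => (fundTensor (funkMetric D) (η t) (deriv η t)).det)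
      (Set.Ioo (-ε) ε) :=
    ContDiffOn.comp (g := fun p : Euc n × Euc n => (fundTensor (funkMetric D) p.1 p.2).det)
      (f := fun t => (η t, deriv η t)) hF.fundTensor_det_smooth
      (hη.smooth.prodMk (hη.smooth.deriv_of_isOpen isOpen_Ioo (by simp))) hmem
  have hpos : ∀ t ∈ Set.Ioo (-ε) ε, 0 < (fundTensor (funkMetric D) (η t) (deriv η t)).det :=
    fun t ht => hF.det_pos (hmem t ht)
  have hsum := hη.eventually_add_deriv hD hε h0 h0' hv
  have hΨ : ∀ᶠ t in nhds (0 : ℝ), HasDerivAt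
      (fun t => Real.log (fundTensor (funkMetric D) (η t) (deriv η t)).det / 2)
      (((n : ℝ) + 1) / 2) t := by
    filter_upwards [hsum.eventually_nhds, Ioo_mem_nhds hz.1 hz.2] with t ht hI
    have hdη : HasDerivAt η (deriv η t) t :=
      ((hη.smooth.differentiableOn (by simp)).differentiableAt (Ioo_mem_nhds hI.1 hI.2)).hasDerivAt
    -- Differentiating `η + η' = x + v` gives `η'' = -η'`.
    have hddη : HasDerivAt (deriv η) ((-1 : ℝ) • deriv η t) t := by
      have : deriv η =ᶠ[nhds t] fun s => x + v - η s := by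
        filter_upwards [ht] with s hs
        rw [← hs, add_sub_cancel_left]
      rw [neg_one_smul]
      exact (hdη.const_sub (x + v)).congr_of_eventuallyEq this
    have hg : ∀ i j, HasDerivAt (fun s => fundTensor (funkMetric D) (η s) (deriv η s) i j)
        ((Matrix.of fun i j => funkMetric D (η t) (deriv η t) *
          (fundTensor (funkMetric D) (η t) (deriv η t) i j
          + partialV (funkMetric D) i (η t) (deriv η t)
            * partialV (funkMetric D) j (η t) (deriv η t))) i j) t := by
      intro i j
      rw [Matrix.of_apply, ← hF.bundleDeriv_fundTensor (hmem t hI) i j (-1)]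
      exact HasFDerivAt.comp_hasDerivAt (f := fun s => (η s, deriv η s)) t
        ((hF.fundTensor_smooth i j).differentiableAt hF.isOpen_slit (hmem t hI)).hasFDerivAt
        (hdη.prodMk hddη)
    have hd := ((hasDerivAt_matrix_det hg).log (hpos t hI).ne').div_const 2
    refine hd.congr_deriv ?_
    rw [hF.trace_adjugate_mul (hmem t hI) (hspeed t hI),
      mul_div_assoc, div_self (hpos t hI).ne', mul_one]
  refine ⟨_, ⟨(hdet.log fun t ht => (hpos t ht).ne').div_const 2, fun t ht => ?_⟩, ?_⟩
  · have hp := hpos t ht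
    rw [← Real.log_sqrt hp.le, Real.exp_neg, Real.exp_log (Real.sqrt_pos.2 hp),
      inv_mul_cancel₀ (Real.sqrt_pos.2 hp).ne']
  · have hev : deriv (fun t => Real.log (fundTensor (funkMetric D) (η t) (deriv η t)).det / 2)
        =ᶠ[nhds 0] fun _ => ((n : ℝ) + 1) / 2 := hΨ.mono fun t ht => ht.deriv
    have hmem0 := hmem 0 hz
    rw [h0, h0'] at hmem0
    rw [hev.deriv_eq, deriv_const, hev.self_of_nhds, hF.ricci_eq hmem0, hv, one_pow, mul_one]
    exact hK

end Weight

end FunkGeometry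

/-! ### The main theorem. -/

theorem theorem1 (n : ℕ) (hn : 2 ≤ n) (D : Set (FunkGeometry.Euc n))
    (hD : FunkGeometry.IsStronglyConvexDomain D) :
    FunkGeometry.IsFinslerStructure D (FunkGeometry.funkMetric D) ∧
    ∀ x ∈ D, ∀ v : FunkGeometry.Euc n, FunkGeometry.funkMetric D x v = 1 →
      FunkGeometry.HasWeightedRicci D (FunkGeometry.funkMetric D)
        ((MeasureTheory.volume : MeasureTheory.Measure (FunkGeometry.Euc n)).restrict D)
        ⊤ x v ((-((n : ℝ) - 1) / 4 : ℝ) : EReal) ∧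
      ∀ N : ℝ, (n : ℝ) < N →
        FunkGeometry.HasWeightedRicci D (FunkGeometry.funkMetric D)
          ((MeasureTheory.volume : MeasureTheory.Measure (FunkGeometry.Euc n)).restrict D)
          (N : EReal) x v
          ((-((n : ℝ) - 1) / 4 - ((n : ℝ) + 1) ^ 2 / (4 * (N - n)) : ℝ) : EReal) := by
  refine ⟨hD.isOkadaMetric.finsler, fun x hx v hv =>
    ⟨hD.hasWeightedRicci hx hv _ _ ?_, fun N hN => hD.hasWeightedRicci hx hv _ _ ?_⟩⟩
  · simp [FunkGeometry.weightedRicciValue]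
  · have h1 : N - n ≠ 0 := (sub_pos.2 hN).ne'
    rw [FunkGeometry.weightedRicciValue, if_neg (EReal.coe_ne_top N),
      if_neg (EReal.coe_injective.ne hN.ne'), EReal.toReal_coe]
    congr 1
    field_simp
    ring
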